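/- For a real symmetric $n\times n$ matrix $A$ with eigenvalues $\lambda_1,\dots,\lambda_n$, let $S_A(z)=\frac1n\sum_{i=1}^n\frac{1}{\lambda_i-z}=\frac1n\mathrm{Tr}(A-zI_n)^{-1}$, for $z\in\mathbb{C}^+=\{z:\operatorname{Im}z>0\}$, be the Stieltjes transform of its spectral empirical measure. For each $n\ge1$ let $\mathbf{X}_n=[X^{(n)}_{k,\ell}]_{k,\ell=1}^n$ be a symmetric matrix whose entries are real-valued random variables, all defined on a common probability space, and suppose the following. (A1) $\mathbb{E}(X^{(n)}_{k,\ell})=0$ for all $1\le\ell\le k\le n$, and there is a constant $C<\infty$ such that for all $n\ge1$ $$\frac1{n^2}\sum_{k=1}^n\sum_{\ell=1}^k\mathbb{E}\big(|X^{(n)}_{k,\ell}|^2\big)\le C.$$ (A2) For every $\tau>0$, $$\frac1{n^2}\sum_{k=1}^n\sum_{\ell=1}^k\mathbb{E}\big(|X^{(n)}_{k,\ell}|^2\mathbf{1}_{|X^{(n)}_{k,\ell}|>\tau\sqrt n}\big)\longrightarrow0\quad(n\to\infty).$$ (A3) There is a positive integer $K$ such that for all $n\ge1$ and all nonempty subsets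 $A,B\subset\{(k,\ell):1\le\ell\le k\le n\}$ with $\min_{(i,j)\in A}\min_{(k,\ell)\in B}\max(|i-k|,|j-\ell|)>K$, the $\sigma$-fields $\sigma(X^{(n)}_{i,j},(i,j)\in A)$ and $\sigma(X^{(n)}_{k,\ell},(k,\ell)\in B)$ are independent. For each $n\ge1$ let $\mathbf{G}_n=[G^{(n)}_{k,\ell}]_{k,\ell=1}^n$ be a symmetric random matrix, on a possibly different probability space, whose entries $(G^{(n)}_{k,\ell})_{1\le\ell\le k\le n}$ are real-valued, centered and jointly Gaussian with $\mathbb{E}(G^{(n)}_{k,\ell}G^{(n)}_{i,j})=\mathbb{E}(X^{(n)}_{k,\ell}X^{(n)}_{i,j})$ for all $1\le\ell\le k\le n$, $1\le j\le i\le n$. Put $\mathbb{X}_n=n^{-1/2}\mathbf{X}_n$ and $\mathbb{G}_n=n^{-1/2}\mathbf{G}_n$. Then, for every $z\in\mathbb{C}^+$, the random variables $S_{\mathbb{G}_n}(z)$ are integrable and $$\lim_{n\to\infty}\big|S_{\mathbb{X}_n}(z)-\mathbb{E}\big(S_{\mathbb{G}_n}(z)\big)\big|=0\quad\text{almost surely.}$$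 -/

import Mathlib

open MeasureTheory ProbabilityTheory Filter Topology

noncomputable section

/-- The spectral empirical measure `(1/n) ∑ δ_{λᵢ}` of a real square matrix all of whose
eigenvalues are real; the `λᵢ` are the roots of the characteristic polynomial, counted with
multiplicity. -/
def spectralMeasure {n : ℕ} (A : Matrix (Fin n) (Fin n) ℝ) : Measure ℝ :=
  ((n : ENNReal)⁻¹) • (A.charpoly.roots.map (fun x => Measure.dirac x)).sum

/-- The Stieltjes transform `S_A(z) = ∫ 1/(x - z) dν_A(x)` of the spectral empirical measure. -/
def stieltjes {n : ℕ} (A : Matrix (Fin n) (Fin n) ℝ) (z : ℂ) : ℂ :=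
  ∫ x : ℝ, 1 / ((x : ℂ) - z) ∂(spectralMeasure A)

/-- For a symmetric matrix, `S_A(z) = (1/n) Tr (A - z I)⁻¹`. -/
theorem stieltjes_eq_trace {n : ℕ} (A : Matrix (Fin n) (Fin n) ℝ) (hA : A.IsSymm)
    (z : ℂ) (hz : 0 < z.im) :
    stieltjes A z = (1 / (n : ℂ)) *
      ((A.map (fun x : ℝ => (x : ℂ)) - z • (1 : Matrix (Fin n) (Fin n) ℂ))⁻¹).trace := by
  have hH : A.IsHermitian := by
    rw [Matrix.IsHermitian, Matrix.conjTranspose_eq_transpose_of_trivial]; exact hA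
  have hne : ∀ x : ℝ, (x : ℂ) - z ≠ 0 := by
    intro x h
    have := congrArg Complex.im h
    simp at this
    exact hz.ne' this
  have h1 : stieltjes A z = (1 / (n : ℂ)) * ∑ i, 1 / ((hH.eigenvalues i : ℂ) - z) := by
    unfold stieltjes spectralMeasure
    have hr : (A.charpoly.roots.map (fun x => Measure.dirac x)).sum
        = ∑ i, Measure.dirac (hH.eigenvalues i) := by
      rw [hH.roots_charpoly_eq_eigenvalues, Multiset.map_map]
      rfl
    rw [hr, integral_smul_measure, integral_finsetSum_measure]
    · simp
    · intro i _
      exact integrable_dirac (by simp)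
  rw [h1]
  congr 1
  let V : Matrix (Fin n) (Fin n) ℝ := hH.eigenvectorUnitary
  let W : Matrix (Fin n) (Fin n) ℝ := star V
  have hVW : V * W = 1 := Unitary.coe_mul_star_self hH.eigenvectorUnitary
  have hWV : W * V = 1 := Unitary.coe_star_mul_self hH.eigenvectorUnitary
  have hs : A = V * Matrix.diagonal hH.eigenvalues * W := by
    have := hH.spectral_theorem
    rw [Unitary.conjStarAlgAut_apply] at this
    exact this
  let φ := (Complex.ofRealHom).mapMatrix (m := Fin n)
  have e1 : φ V * φ W = 1 := by rw [← map_mul, hVW, map_one]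
  have e2 : φ W * φ V = 1 := by rw [← map_mul, hWV, map_one]
  have e3 : A.map (fun x : ℝ => (x : ℂ))
      = φ V * Matrix.diagonal (fun i => (hH.eigenvalues i : ℂ)) * φ W := by
    have : φ A = φ V * φ (Matrix.diagonal hH.eigenvalues) * φ W := by
      rw [← map_mul, ← map_mul, ← hs]
    have hd : φ (Matrix.diagonal hH.eigenvalues)
        = Matrix.diagonal (fun i => (hH.eigenvalues i : ℂ)) := by
      simp [φ, Matrix.diagonal_map]
    rw [← hd, ← this]
    rfl
  have e4 : A.map (fun x : ℝ => (x : ℂ)) - z • (1 : Matrix (Fin n) (Fin n) ℂ)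
      = φ V * Matrix.diagonal (fun i => (hH.eigenvalues i : ℂ) - z) * φ W := by
    have : Matrix.diagonal (fun i => (hH.eigenvalues i : ℂ) - z)
        = Matrix.diagonal (fun i => (hH.eigenvalues i : ℂ)) - z • 1 := by
      rw [Matrix.smul_one_eq_diagonal, Matrix.diagonal_sub]
    rw [e3, this, mul_sub, sub_mul, mul_smul_comm, smul_mul_assoc, mul_one, e1]
  have e5 : (A.map (fun x : ℝ => (x : ℂ)) - z • (1 : Matrix (Fin n) (Fin n) ℂ))⁻¹
      = φ V * Matrix.diagonal (fun i => 1 / ((hH.eigenvalues i : ℂ) - z)) * φ W := by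
    apply Matrix.inv_eq_right_inv
    rw [e4]
    calc _ = φ V * (Matrix.diagonal (fun i => (hH.eigenvalues i : ℂ) - z) * (φ W * φ V) *
          Matrix.diagonal (fun i => 1 / ((hH.eigenvalues i : ℂ) - z))) * φ W := by
          simp only [mul_assoc]
      _ = 1 := by
          have : Matrix.diagonal (fun i => (hH.eigenvalues i : ℂ) - z) *
              Matrix.diagonal (fun i => 1 / ((hH.eigenvalues i : ℂ) - z)) = 1 := by
            rw [Matrix.diagonal_mul_diagonal, ← Matrix.diagonal_one]
            congr 1
            funext i
            exact mul_one_div_cancel (hne _)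
          rw [e2, mul_one, this, mul_one, e1]
  rw [e5, Matrix.trace_mul_comm, ← mul_assoc, e2, one_mul, Matrix.trace_diagonal]

/-- The positions `(k, ℓ)` with `ℓ ≤ k` of an `n × n` matrix (on and below the diagonal). -/
abbrev LowerIdx (n : ℕ) : Type := {p : Fin n × Fin n // p.2 ≤ p.1}

/-- The distance `max (|i - k|, |j - ℓ|)` of two positions `(i, j)` and `(k, ℓ)`. -/
def gridDist {n : ℕ} (p q : LowerIdx n) : ℤ :=
  max |((p.1.1 : ℕ) : ℤ) - ((q.1.1 : ℕ) : ℤ)| |((p.1.2 : ℕ) : ℤ) - ((q.1.2 : ℕ) : ℤ)|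

section Assumptions

variable {Ω : Type*} [MeasurableSpace Ω]

/-- Centered square-integrable entries with bounded normalized sum of second moments. -/
def AssumptionA1 (P : Measure Ω) (X : (n : ℕ) → Ω → Matrix (Fin n) (Fin n) ℝ) : Prop :=
  (∀ n : ℕ, 0 < n → ∀ p : LowerIdx n,
    MemLp (fun ω => X n ω p.1.1 p.1.2) 2 P ∧ ∫ ω, X n ω p.1.1 p.1.2 ∂P = 0) ∧
  ∃ C : ℝ, ∀ n : ℕ, 0 < n →
    (1 / (n : ℝ) ^ 2) * ∑ p : LowerIdx n, ∫ ω, |X n ω p.1.1 p.1.2| ^ 2 ∂P ≤ C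

/-- The Lindeberg condition. -/
def AssumptionA2 (P : Measure Ω) (X : (n : ℕ) → Ω → Matrix (Fin n) (Fin n) ℝ) : Prop :=
  ∀ τ : ℝ, 0 < τ → Tendsto (fun n : ℕ => (1 / (n : ℝ) ^ 2) * ∑ p : LowerIdx n,
    ∫ ω in {ω | τ * √(n : ℝ) < |X n ω p.1.1 p.1.2|}, |X n ω p.1.1 p.1.2| ^ 2 ∂P)
    atTop (𝓝 0)

/-- The σ-field generated by the entries with positions in `A`. -/
abbrev entriesSigma {n : ℕ} (M : Ω → Matrix (Fin n) (Fin n) ℝ) (A : Set (LowerIdx n)) :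
    MeasurableSpace Ω :=
  ⨆ p ∈ A, MeasurableSpace.comap (fun ω => M ω p.1.1 p.1.2) inferInstance

/-- `K`-dependence: entries at positions whose distance is larger than `K` are independent. -/
def AssumptionA3 (P : Measure Ω) (X : (n : ℕ) → Ω → Matrix (Fin n) (Fin n) ℝ) : Prop :=
  ∃ K : ℕ, 0 < K ∧ ∀ n : ℕ, 0 < n → ∀ A B : Set (LowerIdx n), A.Nonempty → B.Nonempty →
    (∀ p ∈ A, ∀ q ∈ B, (K : ℤ) < gridDist p q) →
    Indep (entriesSigma (X n) A) (entriesSigma (X n) B) P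

end Assumptions

end

/-! The proof separates the fluctuation of S_X around its mean from the comparison of the means E
S_X and E S_G. Both use S as a function of the entries on and below the diagonal.

Fluctuation. Reveal the entries row by row. At step i, delete the K+1 rows i, ..., i+K. What remains
splits into rows already known and rows independent of everything revealed up to row i, so its
conditional expectation does not change at this step. The deletion is a perturbation of rank at most
2(K+1) and moves S by O(1/n) (`norm_lowerStieltjes_sub_le`). The martingale increments are therefore
O(1/n) (`abs_condExp_sub_le`), an Azuma bound gives tails of order exp(-cn)
(`measure_lowerStieltjes_ge_le`), and Borel-Cantelli concludes. Only dependence is used here, no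
moments.

Means. Take X and G independent and interpolate by cos θ X + sin θ G. The derivative in θ is a sum
of drifts E[X_a ∂_a S] and E[G_a ∂_a S]. To expand a drift, delete from the field the neighbourhood
N(a). The zeroth-order term vanishes, because X_a is centered and independent of what is left. The
first-order terms contain X_a X_b ∂_a∂_b S with b in N(a); deleting N(b) as well decouples X_a X_b
from the Hessian, leaving Cov(X_a, X_b) E[∂_a∂_b S] up to an error (`norm_drift_sub_le`). Equal
covariances make the second-order terms of the two fields cancel
(`norm_integral_rotation_deriv_le`). The Gaussian field goes through the same expansion, since
uncorrelated blocks of a Gaussian vector are independent (`locallyDependent_of_gaussian`); no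
Gaussian integration by parts is needed.

Errors. The resolvent bound 1/Im z makes second derivatives O(n^{-2}), with relative increments
measured on the scale √n (`lower_taylorData`). Hence the total error is O(n^{-2}) times the sum over
both fields of E[y² min(1, |y|/√n)]. For X this is small by the Lindeberg condition and bounded
average variance; for G the variance decides whether a fourth moment bound or the Lindeberg tail of
X is used (`integral_lindebergWeight_gaussian_le`). -/

section Universality

open scoped Matrix Matrix.Norms.L2Operator

/-! ### Norm and trace bounds for complex matrices -/

section MatrixBounds

variable {m : Type*} [Fintype m] [DecidableEq m]

theorem norm_matrix_single_le (i j : m) (c : ℂ) : ‖Matrix.single i j c‖ ≤ ‖c‖ := by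
  have h := Matrix.l2_opNorm_conjTranspose_mul_self (Matrix.single i j c)
  have h2 : (Matrix.single i j c)ᴴ * Matrix.single i j c
      = Matrix.diagonal (Pi.single j (star c * c)) := by
    rw [Matrix.conjTranspose_single, Matrix.single_mul_single_same, Matrix.diagonal_single]
  rw [h2, Matrix.l2_opNorm_diagonal, Pi.norm_single, norm_mul, norm_star] at h
  exact (abs_le_of_sq_le_sq' (by nlinarith) (norm_nonneg c)).2

theorem norm_le_sum_norm_entries (D : Matrix m m ℂ) : ‖D‖ ≤ ∑ i, ∑ j, ‖D i j‖ := by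
  conv_lhs => rw [Matrix.matrix_eq_sum_single D]
  refine (norm_sum_le _ _).trans (Finset.sum_le_sum fun i _ => ?_)
  exact (norm_sum_le _ _).trans (Finset.sum_le_sum fun j _ => norm_matrix_single_le _ _ _)

theorem norm_entry_le (M : Matrix m m ℂ) (i j : m) : ‖M i j‖ ≤ ‖M‖ := by
  have h := Matrix.l2_opNorm_mulVec M (EuclideanSpace.single j (1 : ℂ))
  rw [PiLp.norm_single, norm_one, mul_one] at h
  refine le_trans ?_ h
  refine le_trans (le_of_eq ?_) (PiLp.norm_apply_le _ i)
  simp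

/-- Pairing the operator norm with the entrywise ℓ¹ norm costs no factor of the dimension. This is
why derivatives of the normalized trace in one entry keep the full gain 1/n. -/
theorem norm_trace_mul_le (M D : Matrix m m ℂ) :
    ‖(M * D).trace‖ ≤ ‖M‖ * ∑ i, ∑ j, ‖D i j‖ := by
  rw [Matrix.trace_mul_comm]
  simp only [Matrix.trace, Matrix.diag, Matrix.mul_apply]
  rw [Finset.mul_sum]
  refine (norm_sum_le _ _).trans (Finset.sum_le_sum fun i _ => ?_)
  rw [Finset.mul_sum]
  refine (norm_sum_le _ _).trans (Finset.sum_le_sum fun j _ => ?_)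
  rw [norm_mul, mul_comm]
  gcongr
  exact norm_entry_le M j i

theorem norm_trace_le_card (M : Matrix m m ℂ) : ‖M.trace‖ ≤ Fintype.card m * ‖M‖ := by
  refine (norm_sum_le _ _).trans ?_
  refine (Finset.sum_le_sum fun i _ => norm_entry_le M i i).trans ?_
  simp

/-- The trace equals the trace of the restriction to the range, a space whose dimension is the rank;
in an orthonormal basis each diagonal coefficient is at most the operator norm. -/
theorem norm_trace_le_rank (M : Matrix m m ℂ) : ‖M.trace‖ ≤ M.rank * ‖M‖ := by
  set T : EuclideanSpace ℂ m →ₗ[ℂ] EuclideanSpace ℂ m := Matrix.toEuclideanLin M with hT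
  have htr : M.trace = LinearMap.trace ℂ _ T := by
    rw [hT, Matrix.toEuclideanLin_eq_toLin_orthonormal, Matrix.trace_toLin_eq]
  have hmem : ∀ x, T x ∈ LinearMap.range T := fun x => LinearMap.mem_range_self T x
  have hr : M.rank = Module.finrank ℂ (LinearMap.range T) := by
    rw [hT, Matrix.toEuclideanLin_eq_toLin_orthonormal]
    exact Matrix.rank_eq_finrank_range_toLin M _ _
  rw [htr, ← LinearMap.trace_restrict_eq_of_forall_mem (LinearMap.range T) T hmem,
    LinearMap.trace_eq_sum_inner _ (stdOrthonormalBasis ℂ (LinearMap.range T)), hr]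
  refine (norm_sum_le _ _).trans ?_
  refine (Finset.sum_le_card_nsmul _ _ ‖M‖ fun i _ => ?_).trans ?_
  · refine (norm_inner_le_norm _ _).trans ?_
    rw [OrthonormalBasis.norm_eq_one, one_mul]
    have := Matrix.l2_opNorm_mulVec M (stdOrthonormalBasis ℂ (LinearMap.range T) i : EuclideanSpace ℂ m)
    have hn : ‖((stdOrthonormalBasis ℂ (LinearMap.range T) i : LinearMap.range T) :
      EuclideanSpace ℂ m)‖ = 1 := by
      rw [← Submodule.coe_norm, OrthonormalBasis.norm_eq_one]
    rw [hn, mul_one] at this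
    exact this
  · simp

end MatrixBounds

/-! ### The resolvent of a Hermitian matrix -/

section Resolvent

variable {m : Type*} [Fintype m] [DecidableEq m]

noncomputable def mresolvent (A : Matrix m m ℂ) (z : ℂ) : Matrix m m ℂ :=
  (A - z • (1 : Matrix m m ℂ))⁻¹

/-- Diagonalization reduces both claims to |λ - z| ≥ Im z for real λ. -/
theorem mresolvent_spec {A : Matrix m m ℂ} (hA : A.IsHermitian) {z : ℂ} (hz : 0 < z.im) :
    (A - z • (1 : Matrix m m ℂ)) * mresolvent A z = 1 ∧ ‖mresolvent A z‖ ≤ z.im⁻¹ := by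
  have him : ∀ x : ℝ, z.im ≤ ‖(x : ℂ) - z‖ := fun x => by
    have := Complex.abs_im_le_norm ((x : ℂ) - z)
    simp at this
    exact (le_abs_self _).trans this
  have hne : ∀ x : ℝ, (x : ℂ) - z ≠ 0 := fun x h => by
    have := him x
    rw [h, norm_zero] at this
    linarith
  set U := hA.eigenvectorUnitary
  set d : m → ℂ := fun i => (hA.eigenvalues i : ℂ) - z
  have hs : A - z • (1 : Matrix m m ℂ)
      = Unitary.conjStarAlgAut ℂ (Matrix m m ℂ) U (Matrix.diagonal d) := by
    have h1 : Matrix.diagonal d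
        = Matrix.diagonal (RCLike.ofReal ∘ hA.eigenvalues) - z • (1 : Matrix m m ℂ) := by
      rw [Matrix.smul_one_eq_diagonal, Matrix.diagonal_sub]
      rfl
    rw [h1, map_sub, ← hA.spectral_theorem, map_smul, map_one]
  have hinv : (A - z • (1 : Matrix m m ℂ)) *
      Unitary.conjStarAlgAut ℂ (Matrix m m ℂ) U (Matrix.diagonal fun i => (d i)⁻¹) = 1 := by
    rw [hs, ← map_mul, Matrix.diagonal_mul_diagonal]
    have : (Matrix.diagonal fun i => d i * (d i)⁻¹) = (1 : Matrix m m ℂ) := by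
      rw [← Matrix.diagonal_one]
      congr 1
      funext i
      exact mul_inv_cancel₀ (hne _)
    rw [this, map_one]
  have hres : mresolvent A z = _ := Matrix.inv_eq_right_inv hinv
  refine ⟨by rw [hres, hinv], ?_⟩
  rw [hres, Unitary.conjStarAlgAut_apply, ← Unitary.coe_star, CStarRing.norm_mul_coe_unitary,
    CStarRing.norm_coe_unitary_mul, Matrix.l2_opNorm_diagonal,
    pi_norm_le_iff_of_nonneg (inv_nonneg.2 hz.le)]
  intro i
  rw [norm_inv]
  exact inv_anti₀ hz (him _)

theorem mresolvent_sub {A B : Matrix m m ℂ} (hA : A.IsHermitian) (hB : B.IsHermitian) {z : ℂ}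
    (hz : 0 < z.im) :
    mresolvent B z - mresolvent A z = - (mresolvent B z * (B - A) * mresolvent A z) := by
  have h1 := (mresolvent_spec hA hz).1
  have h2 := mul_eq_one_comm.1 (mresolvent_spec hB hz).1
  have h3 : B - A = (B - z • (1 : Matrix m m ℂ)) - (A - z • (1 : Matrix m m ℂ)) := by abel
  rw [h3, mul_sub, sub_mul, h2, mul_assoc, h1]
  simp

end Resolvent

/-! ### Perturbation bounds for resolvents in a normed ring -/

section RingBounds

variable {𝔸 : Type*} [NormedRing 𝔸] [NormedAlgebra ℂ 𝔸] {R R' D E : 𝔸} {t : ℂ} {r δ e : ℝ}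

theorem norm_resolvent_sub_le (h : R' - R = -(t • (R' * D * R))) (hR : ‖R‖ ≤ r) (hR' : ‖R'‖ ≤ r)
    (hD : ‖D‖ ≤ δ) : ‖R' - R‖ ≤ ‖t‖ * (r * δ * r) := by
  rw [h, norm_neg, norm_smul]
  gcongr
  exact norm_mul_le_of_le (norm_mul_le_of_le hR' hD) hR

theorem norm_resolvent_sq_sub_le (h : R' - R = -(t • (R' * D * R))) (hR : ‖R‖ ≤ r)
    (hR' : ‖R'‖ ≤ r) (hD : ‖D‖ ≤ δ) : ‖R' * R' - R * R‖ ≤ 2 * ‖t‖ * r ^ 3 * δ := by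
  have h1 := norm_resolvent_sub_le h hR hR' hD
  have h2 : R' * R' - R * R = R' * (R' - R) + (R' - R) * R := by noncomm_ring
  rw [h2]
  calc _ ≤ r * (‖t‖ * (r * δ * r)) + (‖t‖ * (r * δ * r)) * r :=
        (norm_add_le _ _).trans (add_le_add (norm_mul_le_of_le hR' h1) (norm_mul_le_of_le h1 hR))
    _ = _ := by ring

/-- The relation `h` gives R'² - R² = -t(R'²DR + R'DR²); replacing R' by R gives the linearization.
The bound thus controls the Taylor remainder of R², which is quadratic in D. -/
theorem norm_second_order_le (h : R' - R = -(t • (R' * D * R))) (hR : ‖R‖ ≤ r)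
    (hR' : ‖R'‖ ≤ r) (hD : ‖D‖ ≤ δ) :
    ‖(R' * R' * D * R + R' * D * R * R) - (R * R * D * R + R * D * R * R)‖
      ≤ 3 * ‖t‖ * r ^ 4 * δ ^ 2 := by
  have h1 := norm_resolvent_sub_le h hR hR' hD
  have h2 := norm_resolvent_sq_sub_le h hR hR' hD
  have h3 : (R' * R' * D * R + R' * D * R * R) - (R * R * D * R + R * D * R * R)
      = (R' * R' - R * R) * D * R + (R' - R) * D * R * R := by noncomm_ring
  rw [h3]
  calc _ ≤ (2 * ‖t‖ * r ^ 3 * δ) * δ * r + (‖t‖ * (r * δ * r)) * δ * r * r :=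
        (norm_add_le _ _).trans (add_le_add
          (norm_mul_le_of_le (norm_mul_le_of_le h2 hD) hR)
          (norm_mul_le_of_le (norm_mul_le_of_le (norm_mul_le_of_le h1 hD) hR) hR))
    _ = _ := by ring

omit [NormedAlgebra ℂ 𝔸] in
-- Used where D is large and the difference from the linearization is estimated without
-- cancellation.
theorem norm_first_order_le (hR : ‖R‖ ≤ r) (hR' : ‖R'‖ ≤ r) (hD : ‖D‖ ≤ δ) :
    ‖R' * R' * D * R + R' * D * R * R‖ ≤ 2 * r ^ 3 * δ := by
  calc _ ≤ r * r * δ * r + r * δ * r * r := (norm_add_le _ _).trans (add_le_add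
          (norm_mul_le_of_le (norm_mul_le_of_le (norm_mul_le_of_le hR' hR') hD) hR)
          (norm_mul_le_of_le (norm_mul_le_of_le (norm_mul_le_of_le hR' hD) hR) hR))
    _ = _ := by ring

theorem norm_hessian_sub_le (h : R' - R = -(t • (R' * D * R))) (hR : ‖R‖ ≤ r)
    (hR' : ‖R'‖ ≤ r) (hD : ‖D‖ ≤ δ) (hE : ‖E‖ ≤ e) :
    ‖(R' * E * R' * R' + R' * R' * E * R') - (R * E * R * R + R * R * E * R)‖
      ≤ 6 * ‖t‖ * r ^ 4 * δ * e := by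
  have h1 := norm_resolvent_sub_le h hR hR' hD
  have h2 := norm_resolvent_sq_sub_le h hR hR' hD
  have h3 : (R' * E * R' * R' + R' * R' * E * R') - (R * E * R * R + R * R * E * R)
      = (R' * E * (R' * R' - R * R) + (R' - R) * E * R * R) +
        ((R' * R' - R * R) * E * R' + R * R * E * (R' - R)) := by noncomm_ring
  rw [h3]
  calc _ ≤ (r * e * (2 * ‖t‖ * r ^ 3 * δ) + (‖t‖ * (r * δ * r)) * e * r * r) +
        ((2 * ‖t‖ * r ^ 3 * δ) * e * r + r * r * e * (‖t‖ * (r * δ * r))) := by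
        refine (norm_add_le _ _).trans (add_le_add
          ((norm_add_le _ _).trans (add_le_add ?_ ?_)) ((norm_add_le _ _).trans (add_le_add ?_ ?_)))
        · exact norm_mul_le_of_le (norm_mul_le_of_le hR' hE) h2
        · exact norm_mul_le_of_le (norm_mul_le_of_le (norm_mul_le_of_le h1 hE) hR) hR
        · exact norm_mul_le_of_le (norm_mul_le_of_le h2 hE) hR'
        · exact norm_mul_le_of_le (norm_mul_le_of_le (norm_mul_le_of_le hR hR) hE) h1
    _ = _ := by ring

end RingBounds

/-! ### The Stieltjes transform as a function of the entries on and below the diagonal -/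

/-- Quantitative second-order Taylor data of a bounded function of finitely many real variables:
`ψ` is the gradient and `H` the Hessian of `F`. -/
structure TaylorData {ι : Type*} [Fintype ι] (F : (ι → ℝ) → ℂ) (ψ : ι → (ι → ℝ) → ℂ)
    (H : ι → ι → (ι → ℝ) → ℂ) (B c s : ℝ) : Prop where
  bound : ∀ x, ‖F x‖ ≤ B
  grad_bound : ∀ a x, ‖ψ a x‖ ≤ B
  taylor : ∀ x d, ‖F (x + d) - F x - ∑ a, (d a : ℂ) * ψ a x‖ ≤ B * (∑ a, |d a|) ^ 2
  -- The minimum joins two regimes: an error quadratic in d for small increments, and one only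
  -- linear in d for large ones, so that later only second moments are required. In the application
  -- c is of order n^{-2} and s is √n.
  grad_taylor : ∀ a x d, ‖ψ a (x + d) - ψ a x - ∑ b, (d b : ℂ) * H a b x‖
    ≤ c * (∑ b, |d b|) * min 1 ((∑ b, |d b|) / s)
  hess_bound : ∀ a b x, ‖H a b x‖ ≤ c
  hess_sub : ∀ a b x d, ‖H a b (x + d) - H a b x‖ ≤ c * min 1 ((∑ b, |d b|) / s)

section Lower

variable {n : ℕ}

def lowerPos (i j : Fin n) : LowerIdx n := ⟨(max i j, min i j), min_le_max⟩

/-- The complex symmetric matrix with prescribed entries on and below the diagonal. -/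
noncomputable def symMat (n : ℕ) : (LowerIdx n → ℝ) →ₗ[ℝ] Matrix (Fin n) (Fin n) ℂ where
  toFun x := Matrix.of fun i j => ((x (lowerPos i j) : ℝ) : ℂ)
  map_add' x y := by ext i j; simp
  map_smul' c x := by ext i j; simp

theorem symMat_apply (x : LowerIdx n → ℝ) (i j : Fin n) :
    symMat n x i j = ((x (lowerPos i j) : ℝ) : ℂ) := rfl

theorem symMat_isHermitian (x : LowerIdx n → ℝ) (t : ℝ) :
    ((t : ℂ) • symMat n x).IsHermitian := by
  ext i j
  simp [symMat_apply, lowerPos, max_comm, min_comm]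

theorem sum_norm_symMat_le (x : LowerIdx n → ℝ) :
    ∑ i, ∑ j, ‖symMat n x i j‖ ≤ 2 * ∑ a, |x a| := by
  rw [← Finset.sum_product', Finset.univ_product_univ,
    ← Finset.sum_fiberwise (s := Finset.univ) (g := fun q : Fin n × Fin n => lowerPos q.1 q.2),
    Finset.mul_sum]
  refine Finset.sum_le_sum fun a _ => ?_
  have h1 : ∀ q ∈ Finset.univ.filter (fun q : Fin n × Fin n => lowerPos q.1 q.2 = a),
      ‖symMat n x q.1 q.2‖ = |x a| := by
    intro q hq
    rw [symMat_apply, (Finset.mem_filter.1 hq).2]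
    simp
  rw [Finset.sum_congr rfl h1, Finset.sum_const, nsmul_eq_mul]
  refine mul_le_mul_of_nonneg_right ?_ (abs_nonneg _)
  -- The factor 2: a position and its transpose are the only matrix entries filled by one
  -- coordinate.
  have h2 : Finset.univ.filter (fun q : Fin n × Fin n => lowerPos q.1 q.2 = a)
      ⊆ {a.1, a.1.swap} := by
    intro q hq
    have hq := (Finset.mem_filter.1 hq).2
    subst hq
    rcases le_total q.1 q.2 with h | h <;> simp [lowerPos, h]
  exact_mod_cast (Finset.card_le_card h2).trans Finset.card_le_two

theorem norm_symMat_le (x : LowerIdx n → ℝ) : ‖symMat n x‖ ≤ 2 * ∑ a, |x a| :=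
  (norm_le_sum_norm_entries _).trans (sum_norm_symMat_le x)

theorem norm_trace_mul_symMat_le (M : Matrix (Fin n) (Fin n) ℂ) (x : LowerIdx n → ℝ) :
    ‖(M * symMat n x).trace‖ ≤ ‖M‖ * (2 * ∑ a, |x a|) :=
  (norm_trace_mul_le _ _).trans (mul_le_mul_of_nonneg_left (sum_norm_symMat_le x) (norm_nonneg _))

theorem trace_mul_symMat (M : Matrix (Fin n) (Fin n) ℂ) (x : LowerIdx n → ℝ) :
    (M * symMat n x).trace = ∑ a, (x a : ℂ) * (M * symMat n (Pi.single a 1)).trace := by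
  have h : symMat n x = ∑ a, (x a : ℂ) • symMat n (Pi.single a 1) := by
    have : x = ∑ a, x a • (Pi.single a 1 : LowerIdx n → ℝ) := by
      ext b
      simp [Finset.sum_apply, Pi.single_apply]
    conv_lhs => rw [this]
    rw [map_sum]
    refine Finset.sum_congr rfl fun a _ => ?_
    rw [map_smul]
    ext i j
    simp
  rw [h, Finset.mul_sum, Matrix.trace_sum]
  simp

theorem sum_abs_single (a : LowerIdx n) : ∑ b, |(Pi.single a 1 : LowerIdx n → ℝ) b| = 1 := by
  rw [Finset.sum_eq_single a] <;> simp +contextual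

/-- The resolvent at `z` of the symmetric matrix with entries `x`, scaled by `n ^ (-1 / 2)`. -/
noncomputable def lowerResolvent (z : ℂ) (x : LowerIdx n → ℝ) : Matrix (Fin n) (Fin n) ℂ :=
  mresolvent ((((√(n : ℝ))⁻¹ : ℝ) : ℂ) • symMat n x) z

noncomputable def lowerStieltjes (z : ℂ) (x : LowerIdx n → ℝ) : ℂ :=
  (n : ℂ)⁻¹ * (lowerResolvent z x).trace

/-- The derivative of R is -n^{-1/2} R E R, and cyclicity of the trace collects the two resolvents
into R². -/
noncomputable def lowerGrad (z : ℂ) (a : LowerIdx n) (x : LowerIdx n → ℝ) : ℂ :=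
  -((n : ℂ)⁻¹ * (((√(n : ℝ))⁻¹ : ℝ) : ℂ)) *
    (lowerResolvent z x * lowerResolvent z x * symMat n (Pi.single a 1)).trace

/-- Differentiating R² gives R²E_bR + RE_bR²; the trace against E_a is then rotated so that E_b
stands last, making sums against d linear in `symMat n d`. -/
noncomputable def lowerHess (z : ℂ) (a b : LowerIdx n) (x : LowerIdx n → ℝ) : ℂ :=
  ((n : ℂ)⁻¹ * (((√(n : ℝ))⁻¹ : ℝ) : ℂ) * (((√(n : ℝ))⁻¹ : ℝ) : ℂ)) *
    ((lowerResolvent z x * symMat n (Pi.single a 1) * lowerResolvent z x * lowerResolvent z x +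
      lowerResolvent z x * lowerResolvent z x * symMat n (Pi.single a 1) * lowerResolvent z x) *
      symMat n (Pi.single b 1)).trace

variable {z : ℂ}

theorem norm_lowerResolvent_le (hz : 0 < z.im) (x : LowerIdx n → ℝ) :
    ‖lowerResolvent z x‖ ≤ z.im⁻¹ :=
  (mresolvent_spec (symMat_isHermitian x _) hz).2

theorem lowerResolvent_sub (hz : 0 < z.im) (x d : LowerIdx n → ℝ) :
    lowerResolvent z (x + d) - lowerResolvent z x =
      -((((√(n : ℝ))⁻¹ : ℝ) : ℂ) • (lowerResolvent z (x + d) * symMat n d * lowerResolvent z x)) := by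
  unfold lowerResolvent
  rw [mresolvent_sub (symMat_isHermitian x _) (symMat_isHermitian (x + d) _) hz, ← smul_sub,
    map_add, add_sub_cancel_left]
  simp

theorem stieltjes_eq_lowerStieltjes (A : Matrix (Fin n) (Fin n) ℝ) (hA : A.IsSymm)
    (hz : 0 < z.im) :
    stieltjes ((√(n : ℝ))⁻¹ • A) z = lowerStieltjes z (fun p : LowerIdx n => A p.1.1 p.1.2) := by
  rw [stieltjes_eq_trace _ (hA.smul _) z hz, lowerStieltjes, lowerResolvent, mresolvent, one_div]
  congr 5
  ext i j
  rcases le_total i j with h | h <;>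
  simp [symMat_apply, lowerPos, h, hA.apply]

theorem norm_ofReal_inv_sqrt (n : ℕ) : ‖(((√(n : ℝ))⁻¹ : ℝ) : ℂ)‖ = (√(n : ℝ))⁻¹ := by
  rw [Complex.norm_real, Real.norm_of_nonneg (inv_nonneg.2 (Real.sqrt_nonneg _))]

theorem norm_symMat_single_le (a : LowerIdx n) : ‖symMat n (Pi.single a 1)‖ ≤ 2 := by
  have := norm_symMat_le (n := n) (Pi.single a 1)
  rwa [sum_abs_single, mul_one] at this

theorem norm_trace_mul_symMat_single_le (M : Matrix (Fin n) (Fin n) ℂ) (a : LowerIdx n) :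
    ‖(M * symMat n (Pi.single a 1)).trace‖ ≤ ‖M‖ * 2 := by
  have := norm_trace_mul_symMat_le M (Pi.single a 1)
  rwa [sum_abs_single, mul_one] at this

theorem norm_lowerScale_sq (n : ℕ) :
    ‖(n : ℂ)⁻¹ * (((√(n : ℝ))⁻¹ : ℝ) : ℂ) * (((√(n : ℝ))⁻¹ : ℝ) : ℂ)‖ = ((n : ℝ) ^ 2)⁻¹ := by
  rw [norm_mul, norm_mul, norm_ofReal_inv_sqrt, norm_inv, Complex.norm_natCast, mul_assoc,
    ← mul_inv, Real.mul_self_sqrt (Nat.cast_nonneg n), ← mul_inv, sq]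

theorem norm_lowerStieltjes_le (hn : 0 < n) (hz : 0 < z.im) (x : LowerIdx n → ℝ) :
    ‖lowerStieltjes z x‖ ≤ z.im⁻¹ := by
  have hn' : (0 : ℝ) < n := Nat.cast_pos.2 hn
  rw [lowerStieltjes, norm_mul, norm_inv, Complex.norm_natCast]
  have := (norm_trace_le_card (lowerResolvent z x)).trans
    (mul_le_mul_of_nonneg_left (norm_lowerResolvent_le hz x) (by positivity))
  rw [Fintype.card_fin] at this
  calc _ ≤ (n : ℝ)⁻¹ * (n * z.im⁻¹) := by gcongr
    _ = z.im⁻¹ := by field_simp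

theorem norm_lowerGrad_le (hz : 0 < z.im) (a : LowerIdx n) (x : LowerIdx n → ℝ) :
    ‖lowerGrad z a x‖ ≤ (n : ℝ)⁻¹ * (√(n : ℝ))⁻¹ * (z.im⁻¹ * z.im⁻¹ * 2) := by
  rw [lowerGrad, norm_mul, norm_neg, norm_mul, norm_ofReal_inv_sqrt, norm_inv,
    Complex.norm_natCast]
  gcongr
  refine (norm_trace_mul_symMat_single_le _ _).trans ?_
  gcongr
  exact norm_mul_le_of_le (norm_lowerResolvent_le hz x) (norm_lowerResolvent_le hz x)

theorem norm_lowerHess_le (hz : 0 < z.im) (a b : LowerIdx n) (x : LowerIdx n → ℝ) :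
    ‖lowerHess z a b x‖ ≤ ((n : ℝ) ^ 2)⁻¹ * (8 * z.im⁻¹ ^ 3) := by
  rw [lowerHess, norm_mul, norm_lowerScale_sq]
  gcongr
  refine (norm_trace_mul_symMat_single_le _ _).trans ?_
  have := norm_first_order_le (norm_lowerResolvent_le hz x) (norm_lowerResolvent_le hz x)
    (norm_symMat_single_le a)
  rw [add_comm] at this
  linarith

theorem sum_mul_lowerGrad (x d : LowerIdx n → ℝ) :
    ∑ a, (d a : ℂ) * lowerGrad z a x = -((n : ℂ)⁻¹ * (((√(n : ℝ))⁻¹ : ℝ) : ℂ)) *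
      (lowerResolvent z x * lowerResolvent z x * symMat n d).trace := by
  rw [trace_mul_symMat _ d, Finset.mul_sum]
  exact Finset.sum_congr rfl fun a _ => by rw [lowerGrad]; ring

theorem lowerStieltjes_sub (hz : 0 < z.im) (x d : LowerIdx n → ℝ) :
    lowerStieltjes z (x + d) - lowerStieltjes z x =
      -((n : ℂ)⁻¹ * (((√(n : ℝ))⁻¹ : ℝ) : ℂ)) *
      (lowerResolvent z x * lowerResolvent z (x + d) * symMat n d).trace := by
  rw [lowerStieltjes, lowerStieltjes, ← mul_sub, ← Matrix.trace_sub, lowerResolvent_sub hz x d,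
    Matrix.trace_neg, Matrix.trace_smul, mul_assoc (lowerResolvent z x),
    Matrix.trace_mul_comm (lowerResolvent z x), smul_eq_mul]
  ring

/-- The available factor n^{-2} is dropped: this remainder only serves differentiability, so its
size is irrelevant. -/
theorem norm_lowerStieltjes_taylor_le (hn : 0 < n) (hz : 0 < z.im) (x d : LowerIdx n → ℝ) :
    ‖lowerStieltjes z (x + d) - lowerStieltjes z x - ∑ a, (d a : ℂ) * lowerGrad z a x‖
      ≤ 4 * z.im⁻¹ ^ 3 * (∑ a, |d a|) ^ 2 := by
  rw [lowerStieltjes_sub hz, sum_mul_lowerGrad, ← mul_sub, ← Matrix.trace_sub, ← sub_mul,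
    ← mul_sub, norm_mul, norm_neg]
  have h2 := norm_resolvent_sub_le (lowerResolvent_sub hz x d) (norm_lowerResolvent_le hz x)
    (norm_lowerResolvent_le hz (x + d)) (norm_symMat_le d)
  have h3 := norm_trace_mul_symMat_le
    (lowerResolvent z x * (lowerResolvent z (x + d) - lowerResolvent z x)) d
  have h4 := norm_mul_le_of_le (norm_lowerResolvent_le hz x) h2
  have hk := norm_lowerScale_sq n
  rw [norm_mul] at hk
  have hn1 : (1 : ℝ) ≤ n := by exact_mod_cast hn
  set N := ∑ a, |d a|
  have hN0 : 0 ≤ N := Finset.sum_nonneg fun _ _ => abs_nonneg _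
  have hr : 0 < z.im⁻¹ := inv_pos.2 hz
  calc _ ≤ _ * (_ * (2 * N)) := mul_le_mul_of_nonneg_left
        (h3.trans (mul_le_mul_of_nonneg_right h4 (by positivity))) (norm_nonneg _)
    _ = (‖(n : ℂ)⁻¹ * (((√(n : ℝ))⁻¹ : ℝ) : ℂ)‖ * ‖(((√(n : ℝ))⁻¹ : ℝ) : ℂ)‖) *
        (4 * z.im⁻¹ ^ 3 * N ^ 2) := by ring
    _ ≤ 1 * (4 * z.im⁻¹ ^ 3 * N ^ 2) := by
        rw [hk]
        gcongr
        exact inv_le_one_of_one_le₀ (one_le_pow₀ hn1)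
    _ = 4 * z.im⁻¹ ^ 3 * N ^ 2 := one_mul _

theorem sum_mul_lowerHess (a : LowerIdx n) (x d : LowerIdx n → ℝ) :
    ∑ b, (d b : ℂ) * lowerHess z a b x =
      ((n : ℂ)⁻¹ * (((√(n : ℝ))⁻¹ : ℝ) : ℂ) * (((√(n : ℝ))⁻¹ : ℝ) : ℂ)) *
      ((lowerResolvent z x * lowerResolvent z x * symMat n d * lowerResolvent z x +
        lowerResolvent z x * symMat n d * lowerResolvent z x * lowerResolvent z x) *
        symMat n (Pi.single a 1)).trace := by
  have e0 : ∀ R D E : Matrix (Fin n) (Fin n) ℂ, ((R * R * D * R + R * D * R * R) * E).trace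
      = ((R * E * R * R + R * R * E * R) * D).trace := by
    intro R D E
    rw [add_mul, add_mul, Matrix.trace_add, Matrix.trace_add]
    refine congrArg₂ (· + ·) ?_ ?_
    · rw [Matrix.mul_assoc (R * R * D), Matrix.trace_mul_comm (R * R * D)]
      simp only [Matrix.mul_assoc]
    · rw [Matrix.mul_assoc (R * D), Matrix.mul_assoc (R * D), Matrix.trace_mul_comm (R * D)]
      simp only [Matrix.mul_assoc]
  rw [e0, trace_mul_symMat _ d, Finset.mul_sum]
  exact Finset.sum_congr rfl fun b _ => by rw [lowerHess]; ring

/-- An exact formula, equal to that of `sum_mul_lowerHess` except that some resolvents are taken at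
x + d. The Taylor remainder is therefore a difference of resolvents. -/
theorem lowerGrad_sub (hz : 0 < z.im) (a : LowerIdx n) (x d : LowerIdx n → ℝ) :
    lowerGrad z a (x + d) - lowerGrad z a x =
      ((n : ℂ)⁻¹ * (((√(n : ℝ))⁻¹ : ℝ) : ℂ) * (((√(n : ℝ))⁻¹ : ℝ) : ℂ)) *
      ((lowerResolvent z (x + d) * lowerResolvent z (x + d) * symMat n d * lowerResolvent z x +
        lowerResolvent z (x + d) * symMat n d * lowerResolvent z x * lowerResolvent z x) *
        symMat n (Pi.single a 1)).trace := by
  have h1 := lowerResolvent_sub hz x d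
  rw [lowerGrad, lowerGrad]
  generalize lowerResolvent z x = R at h1 ⊢
  generalize lowerResolvent z (x + d) = R' at h1 ⊢
  generalize symMat n d = D at h1 ⊢
  generalize symMat n (Pi.single a 1) = E
  generalize (((√(n : ℝ))⁻¹ : ℝ) : ℂ) = t at h1 ⊢
  have e3 : R' * R' - R * R = -(t • (R' * R' * D * R + R' * D * R * R)) := by
    have : R' * R' - R * R = R' * (R' - R) + (R' - R) * R := by noncomm_ring
    rw [this, h1]
    simp only [mul_neg, neg_mul, mul_smul_comm, smul_mul_assoc, mul_assoc, smul_add]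
    abel
  have e4 : (R' * R' * E).trace - (R * R * E).trace
      = - (t * ((R' * R' * D * R + R' * D * R * R) * E).trace) := by
    rw [← Matrix.trace_sub, ← sub_mul, e3, neg_mul, smul_mul_assoc, Matrix.trace_neg,
      Matrix.trace_smul, smul_eq_mul]
  rw [← mul_sub, e4]
  ring

/-- The regime of large d: increment and linear term are bounded separately. -/
theorem norm_lowerGrad_taylor_le (hz : 0 < z.im) (a : LowerIdx n) (x d : LowerIdx n → ℝ) :
    ‖lowerGrad z a (x + d) - lowerGrad z a x - ∑ b, (d b : ℂ) * lowerHess z a b x‖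
      ≤ ((n : ℝ) ^ 2)⁻¹ * (16 * z.im⁻¹ ^ 3 * ∑ b, |d b|) := by
  rw [lowerGrad_sub hz, sum_mul_lowerHess, ← mul_sub, norm_mul, norm_lowerScale_sq]
  have hR := norm_lowerResolvent_le hz x
  have hR' := norm_lowerResolvent_le hz (x + d)
  refine mul_le_mul_of_nonneg_left ((norm_sub_le _ _).trans ?_) (by positivity)
  have h5 := (norm_trace_mul_symMat_single_le _ a).trans (mul_le_mul_of_nonneg_right
    (norm_first_order_le hR hR' (norm_symMat_le d)) zero_le_two)
  have h6 := (norm_trace_mul_symMat_single_le _ a).trans (mul_le_mul_of_nonneg_right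
    (norm_first_order_le hR hR (norm_symMat_le d)) zero_le_two)
  linarith

/-- The regime of small d: the scale n^{-1/2} in the resolvent identity yields the extra factor (∑
|d b|)/√n. -/
theorem norm_lowerGrad_taylor_le_sq (hz : 0 < z.im) (a : LowerIdx n) (x d : LowerIdx n → ℝ) :
    ‖lowerGrad z a (x + d) - lowerGrad z a x - ∑ b, (d b : ℂ) * lowerHess z a b x‖
      ≤ ((n : ℝ) ^ 2)⁻¹ * (24 * z.im⁻¹ ^ 4 * ((∑ b, |d b|) * ((∑ b, |d b|) / √(n : ℝ)))) := by
  rw [lowerGrad_sub hz, sum_mul_lowerHess, ← mul_sub, norm_mul, norm_lowerScale_sq,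
    ← Matrix.trace_sub, ← sub_mul]
  refine mul_le_mul_of_nonneg_left ?_ (by positivity)
  have h5 := (norm_trace_mul_symMat_single_le _ a).trans (mul_le_mul_of_nonneg_right
    (norm_second_order_le (lowerResolvent_sub hz x d) (norm_lowerResolvent_le hz x)
      (norm_lowerResolvent_le hz (x + d)) (norm_symMat_le d)) zero_le_two)
  rw [norm_ofReal_inv_sqrt] at h5
  refine h5.trans (le_of_eq ?_)
  rw [div_eq_inv_mul]
  ring

theorem norm_lowerHess_sub_le (hz : 0 < z.im) (a b : LowerIdx n) (x d : LowerIdx n → ℝ) :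
    ‖lowerHess z a b (x + d) - lowerHess z a b x‖
      ≤ ((n : ℝ) ^ 2)⁻¹ * (48 * z.im⁻¹ ^ 4 * ((∑ b, |d b|) / √(n : ℝ))) := by
  rw [lowerHess, lowerHess, ← mul_sub, norm_mul, norm_lowerScale_sq, ← Matrix.trace_sub, ← sub_mul]
  refine mul_le_mul_of_nonneg_left ?_ (by positivity)
  have h6 := (norm_trace_mul_symMat_single_le _ b).trans (mul_le_mul_of_nonneg_right
    (norm_hessian_sub_le (lowerResolvent_sub hz x d) (norm_lowerResolvent_le hz x)
      (norm_lowerResolvent_le hz (x + d)) (norm_symMat_le d) (norm_symMat_single_le a)) zero_le_two)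
  rw [norm_ofReal_inv_sqrt] at h6
  refine h6.trans (le_of_eq ?_)
  rw [div_eq_inv_mul]
  ring

/-- Only c and s enter the quantitative comparison; B serves for integrability and differentiability
and may be any number. The constant c dominates all the numerical factors of the preceding bounds at
once. -/
theorem lower_taylorData (hn : 0 < n) (hz : 0 < z.im) :
    ∃ B, TaylorData (lowerStieltjes (n := n) z) (lowerGrad z) (lowerHess z) B
      ((16 * z.im⁻¹ ^ 3 + 48 * z.im⁻¹ ^ 4) / (n : ℝ) ^ 2) (√(n : ℝ)) := by
  have hr3 := pow_pos (inv_pos.2 hz) 3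
  have hr4 := pow_pos (inv_pos.2 hz) 4
  have hN : ∀ d : LowerIdx n → ℝ, 0 ≤ ∑ a, |d a| :=
    fun d => Finset.sum_nonneg fun _ _ => abs_nonneg _
  have hc : ∀ {k y : ℝ}, k ≤ 16 * z.im⁻¹ ^ 3 + 48 * z.im⁻¹ ^ 4 → 0 ≤ y →
      ((n : ℝ) ^ 2)⁻¹ * (k * y) ≤ (16 * z.im⁻¹ ^ 3 + 48 * z.im⁻¹ ^ 4) / (n : ℝ) ^ 2 * y := by
    intro k y hk hy
    rw [div_eq_inv_mul, mul_assoc]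
    gcongr
  refine ⟨max z.im⁻¹ (max ((n : ℝ)⁻¹ * (√(n : ℝ))⁻¹ * (z.im⁻¹ * z.im⁻¹ * 2)) (4 * z.im⁻¹ ^ 3)),
    ⟨fun x => ?_, fun a x => ?_, fun x d => ?_, fun a x d => ?_, fun a b x => ?_,
    fun a b x d => ?_⟩⟩
  · exact (norm_lowerStieltjes_le hn hz x).trans (le_max_left _ _)
  · exact (norm_lowerGrad_le hz a x).trans ((le_max_left _ _).trans (le_max_right _ _))
  · refine (norm_lowerStieltjes_taylor_le hn hz x d).trans ?_
    gcongr
    exact (le_max_right _ _).trans (le_max_right _ _)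
  · rw [mul_min_of_nonneg _ _ (by have := hN d; positivity), mul_one]
    refine le_min ((norm_lowerGrad_taylor_le hz a x d).trans (hc (by linarith) (hN d)))
      ((norm_lowerGrad_taylor_le_sq hz a x d).trans ?_)
    rw [mul_assoc (_ / _)]
    exact hc (by linarith) (by have := hN d; positivity)
  · refine (norm_lowerHess_le hz a b x).trans ?_
    have := hc (k := 8 * z.im⁻¹ ^ 3) (y := 1) (by linarith) zero_le_one
    simpa using this
  · rw [mul_min_of_nonneg _ _ (by positivity)]
    refine le_min ((norm_sub_le _ _).trans ((add_le_add (norm_lowerHess_le hz a b _)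
      (norm_lowerHess_le hz a b _)).trans ?_)) ((norm_lowerHess_sub_le hz a b x d).trans
      (hc (by linarith) (by have := hN d; positivity)))
    have := hc (k := 16 * z.im⁻¹ ^ 3) (y := 1) (by linarith) zero_le_one
    linarith

theorem matrix_rank_add_le (A B : Matrix (Fin n) (Fin n) ℂ) : (A + B).rank ≤ A.rank + B.rank := by
  unfold Matrix.rank
  refine le_trans (Submodule.finrank_mono ?_) (Submodule.finrank_add_le_finrank_add_finrank _ _)
  rw [Matrix.mulVecLin_add]
  exact LinearMap.range_add_le _ _

/-- Changing the entries in the rows of index in `S` is a perturbation of rank at most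
`2 * S.card`. -/
theorem norm_lowerStieltjes_sub_le (hn : 0 < n) (hz : 0 < z.im) (S : Finset (Fin n))
    (x y : LowerIdx n → ℝ) (h : ∀ a : LowerIdx n, a.1.1 ∉ S → x a = y a) :
    ‖lowerStieltjes z y - lowerStieltjes z x‖ ≤ 4 * S.card * z.im⁻¹ / n := by
  obtain ⟨d, rfl⟩ : ∃ d, y = x + d := ⟨y - x, by simp⟩
  have hd : ∀ a : LowerIdx n, a.1.1 ∉ S → d a = 0 := fun a ha => by
    have := h a ha
    simpa using this
  set D := symMat n d
  set Q : Matrix (Fin n) (Fin n) ℂ := Matrix.diagonal fun i => if i ∈ S then 1 else 0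
  have hQ : Q.rank ≤ S.card := by
    rw [Matrix.rank_diagonal]
    refine le_of_eq ?_
    rw [Fintype.card_subtype]
    congr 1
    ext i
    simp
  -- This says (1 - Q)D(1 - Q) = 0: an entry with both indices outside S sits at a lower position
  -- whose row is outside S, where d vanishes. Each summand has a factor Q, hence rank at most |S|.
  have hD : D = Q * D + (D - Q * D) * Q := by
    ext i j
    simp only [Q, D, Matrix.add_apply, Matrix.diagonal_mul, Matrix.mul_diagonal, Matrix.sub_apply]
    by_cases hi : i ∈ S
    · simp [hi]
    · by_cases hj : j ∈ S
      · simp [hj, hi]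
      · have : symMat n d i j = 0 := by
          rw [symMat_apply, hd, Complex.ofReal_zero]
          rcases le_total i j with h | h <;> simp [lowerPos, h, hi, hj]
        simp [this]
  have hrD : D.rank ≤ 2 * S.card := by
    rw [hD]
    refine (matrix_rank_add_le _ _).trans ?_
    have h1 := (Matrix.rank_mul_le_left Q D).trans hQ
    have h2 := (Matrix.rank_mul_le_right (D - Q * D) Q).trans hQ
    omega
  have h1 := lowerResolvent_sub hz x d
  set M := lowerResolvent z (x + d) - lowerResolvent z x
  -- By the resolvent identity M has D as a factor, so it inherits the rank bound; its norm need not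
  -- be small.
  have hrM : M.rank ≤ 2 * S.card := by
    rw [h1, ← neg_smul, ← smul_mul_assoc]
    exact (Matrix.rank_mul_le_left _ _).trans <| by
      rw [← smul_mul_assoc]
      exact (Matrix.rank_mul_le_right _ _).trans hrD
  have hM : ‖M‖ ≤ 2 * z.im⁻¹ := by
    refine (norm_sub_le _ _).trans ?_
    linarith [norm_lowerResolvent_le hz x, norm_lowerResolvent_le hz (x + d)]
  have hn' : (0 : ℝ) < n := Nat.cast_pos.2 hn
  rw [lowerStieltjes, lowerStieltjes, ← mul_sub, ← Matrix.trace_sub, norm_mul]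
  have h2 : (M.rank : ℝ) ≤ 2 * S.card := by exact_mod_cast hrM
  calc _ ≤ (n : ℝ)⁻¹ * ((2 * S.card) * (2 * z.im⁻¹)) := by
        rw [norm_inv, Complex.norm_natCast]
        exact mul_le_mul_of_nonneg_left ((norm_trace_le_rank M).trans
          (mul_le_mul h2 hM (norm_nonneg _)
            (mul_nonneg zero_le_two (Nat.cast_nonneg _)))) (inv_nonneg.2 hn'.le)
    _ = _ := by rw [div_eq_inv_mul]; ring

end Lower

/-! ### Smoothness of functions with Taylor data -/

section Smooth

variable {ι : Type*} [Fintype ι] {F : (ι → ℝ) → ℂ} {ψ : ι → (ι → ℝ) → ℂ}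
  {H : ι → ι → (ι → ℝ) → ℂ} {B c s : ℝ}

theorem continuous_of_norm_sub_le {f : (ι → ℝ) → ℂ} {C : ℝ}
    (h : ∀ x d, ‖f (x + d) - f x‖ ≤ C * ∑ a, |d a|) : Continuous f := by
  rw [continuous_iff_continuousAt]
  intro x
  rw [ContinuousAt, tendsto_iff_norm_sub_tendsto_zero]
  have h1 : Tendsto (fun y : ι → ℝ => C * ∑ a, |(y - x) a|) (𝓝 x) (𝓝 0) := by
    have : Continuous fun y : ι → ℝ => C * ∑ a, |(y - x) a| := by
      simp only [Pi.sub_apply]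
      fun_prop
    simpa using this.tendsto x
  refine squeeze_zero (fun _ => norm_nonneg _) (fun y => ?_) h1
  simpa using h x (y - x)

theorem sum_abs_nonneg (d : ι → ℝ) : 0 ≤ ∑ a, |d a| := Finset.sum_nonneg fun _ _ => abs_nonneg _

namespace TaylorData

theorem coeff_nonneg [Nonempty ι] (h : TaylorData F ψ H B c s) : 0 ≤ c :=
  (norm_nonneg _).trans (h.hess_bound (Classical.arbitrary ι) (Classical.arbitrary ι) 0)

theorem continuous_hess [Nonempty ι] (h : TaylorData F ψ H B c s) (a b : ι) :
    Continuous (H a b) := by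
  refine continuous_of_norm_sub_le (C := c / s) fun x d => (h.hess_sub a b x d).trans ?_
  calc c * min 1 ((∑ b, |d b|) / s) ≤ c * ((∑ b, |d b|) / s) :=
        mul_le_mul_of_nonneg_left (min_le_right _ _) h.coeff_nonneg
    _ = _ := by ring

theorem continuous_grad [Nonempty ι] (h : TaylorData F ψ H B c s) (a : ι) :
    Continuous (ψ a) := by
  refine continuous_of_norm_sub_le (C := 2 * c) fun x d => ?_
  have h1 := h.grad_taylor a x d
  have h2 : ‖∑ b, (d b : ℂ) * H a b x‖ ≤ c * ∑ b, |d b| := by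
    rw [Finset.mul_sum]
    refine (norm_sum_le _ _).trans (Finset.sum_le_sum fun b _ => ?_)
    rw [norm_mul, Complex.norm_real, Real.norm_eq_abs, mul_comm]
    exact mul_le_mul_of_nonneg_right (h.hess_bound a b x) (abs_nonneg _)
  have h3 : c * (∑ b, |d b|) * min 1 ((∑ b, |d b|) / s) ≤ c * (∑ b, |d b|) :=
    mul_le_of_le_one_right (mul_nonneg h.coeff_nonneg (sum_abs_nonneg d)) (min_le_left _ _)
  calc ‖ψ a (x + d) - ψ a x‖
      = ‖(ψ a (x + d) - ψ a x - ∑ b, (d b : ℂ) * H a b x) + ∑ b, (d b : ℂ) * H a b x‖ := by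
        rw [sub_add_cancel]
    _ ≤ _ := (norm_add_le _ _).trans (by linarith)

theorem hasFDerivAt (h : TaylorData F ψ H B c s) (x : ι → ℝ) :
    HasFDerivAt F (∑ a, (ContinuousLinearMap.proj (R := ℝ) (φ := fun _ : ι => ℝ) a).smulRight
      (ψ a x)) x := by
  rw [hasFDerivAt_iff_isLittleO_nhds_zero]
  have hB : 0 ≤ B := (norm_nonneg _).trans (h.bound x)
  refine Asymptotics.IsBigO.trans_isLittleO (g := fun d : ι → ℝ => ‖d‖ ^ 2) ?_
    (Asymptotics.isLittleO_norm_pow_id one_lt_two)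
  refine Asymptotics.IsBigO.of_bound (B * Fintype.card ι ^ 2) (Eventually.of_forall fun d => ?_)
  have h1 : ∑ a, |d a| ≤ Fintype.card ι * ‖d‖ := by
    refine (Finset.sum_le_card_nsmul _ _ ‖d‖ fun a _ => norm_le_pi_norm d a).trans ?_
    simp
  have h2 := h.taylor x d
  simp only [_root_.sum_apply, ContinuousLinearMap.smulRight_apply,
    ContinuousLinearMap.proj_apply, Complex.real_smul, norm_pow, norm_norm]
  refine h2.trans ?_
  rw [mul_assoc, ← mul_pow]
  have := sum_abs_nonneg d
  gcongr

theorem continuous (h : TaylorData F ψ H B c s) : Continuous F :=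
  continuous_iff_continuousAt.2 fun x => (h.hasFDerivAt x).continuousAt

end TaylorData

end Smooth

/-! ### The truncated third moment -/

/-- It is |y|³/s for |y| ≤ s and y² beyond: as good as a third moment on small values, yet
integrable with only second moments. -/
noncomputable def lindebergWeight (s y : ℝ) : ℝ := y ^ 2 * min 1 (|y| / s)

section Weight

variable {s : ℝ}

theorem lindebergWeight_nonneg (hs : 0 ≤ s) (y : ℝ) : 0 ≤ lindebergWeight s y := by
  unfold lindebergWeight
  positivity

theorem lindebergWeight_le_sq (s y : ℝ) : lindebergWeight s y ≤ y ^ 2 :=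
  mul_le_of_le_one_right (sq_nonneg y) (min_le_left _ _)

theorem measurable_lindebergWeight (s : ℝ) : Measurable (lindebergWeight s) := by
  unfold lindebergWeight
  fun_prop

theorem abs_mul_abs_mul_le_of_max (hs : 0 ≤ s) {u v y t : ℝ} (hu : |u| ≤ |t|) (hv : |v| ≤ |t|)
    (hy : |y| ≤ |t|) : |u| * |v| * min 1 (|y| / s) ≤ lindebergWeight s t := by
  unfold lindebergWeight
  rw [← sq_abs t, sq]
  gcongr

/-- A mixed product is at most the weight of whichever of the three variables is largest in absolute
value. -/
theorem abs_mul_abs_mul_min_le (hs : 0 ≤ s) (u v y : ℝ) :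
    |u| * |v| * min 1 (|y| / s) ≤ lindebergWeight s u + lindebergWeight s v
      + lindebergWeight s y := by
  have h1 := lindebergWeight_nonneg hs u
  have h2 := lindebergWeight_nonneg hs v
  have h3 := lindebergWeight_nonneg hs y
  rcases le_total |u| |v| with huv | huv <;> rcases le_total |u| |y| with huy | huy <;>
    rcases le_total |v| |y| with hvy | hvy
  · linarith [abs_mul_abs_mul_le_of_max hs huy hvy le_rfl]
  · linarith [abs_mul_abs_mul_le_of_max hs huv le_rfl hvy]
  · linarith [abs_mul_abs_mul_le_of_max hs (huv.trans hvy) hvy le_rfl]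
  · linarith [abs_mul_abs_mul_le_of_max hs huv le_rfl hvy]
  · linarith [abs_mul_abs_mul_le_of_max hs huy hvy le_rfl]
  · linarith [abs_mul_abs_mul_le_of_max hs huy (huv.trans huy) le_rfl]
  · linarith [abs_mul_abs_mul_le_of_max hs le_rfl huv huy]
  · linarith [abs_mul_abs_mul_le_of_max hs le_rfl huv huy]

/-- Subadditivity of u ↦ min(1, u) on nonnegative reals; it reduces the effect of deleting a
neighbourhood to single coordinates. -/
theorem min_one_sum_div_le {ι : Type*} (hs : 0 ≤ s) (S : Finset ι) (d : ι → ℝ) :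
    min 1 ((∑ b ∈ S, |d b|) / s) ≤ ∑ b ∈ S, min 1 (|d b| / s) := by
  classical
  induction S using Finset.induction_on with
  | empty => simp
  | insert a S ha ih =>
    rw [Finset.sum_insert ha, Finset.sum_insert ha, add_div]
    refine le_trans ?_ (add_le_add_right ih _)
    have h1 : 0 ≤ |d a| / s := by positivity
    have h2 : 0 ≤ (∑ b ∈ S, |d b|) / s :=
      div_nonneg (Finset.sum_nonneg fun _ _ => abs_nonneg _) hs
    rcases le_total 1 (|d a| / s) with h3 | h3 <;>
      rcases le_total 1 ((∑ b ∈ S, |d b|) / s) with h4 | h4 <;>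
      simp only [min_eq_left, min_eq_right, h3, h4, min_le_iff] <;>
      first
      | (left; linarith)
      | (right; linarith)

end Weight

/-! ### Locally dependent fields -/

/-- A law on `ι → ℝ` such that coordinates in `S` and in `T` are independent as soon as `T` does
not meet the neighbourhoods `N a`, `a ∈ S`. -/
def LocallyDependent {ι : Type*} (N : ι → Finset ι) (μ : Measure (ι → ℝ)) : Prop :=
  ∀ S T : Set ι, (∀ a ∈ S, ∀ b ∈ T, b ∉ N a) →
    IndepFun (fun x : ι → ℝ => S.indicator x) (fun x : ι → ℝ => T.indicator x) μ

theorem measurable_indicator_pi {ι : Type*} (S : Set ι) :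
    Measurable fun x : ι → ℝ => S.indicator x := by
  classical
  refine measurable_pi_iff.2 fun a => ?_
  by_cases h : a ∈ S
  · simpa [Set.indicator, h] using measurable_pi_apply a
  · simp [Set.indicator, h]

/-- Double counting: by symmetry of the neighbourhoods each b is counted at most |N b| times. -/
theorem sum_sum_neighbours_le {ι : Type*} [Fintype ι] {N : ι → Finset ι} {m : ℕ}
    (hsymm : ∀ a b, b ∈ N a → a ∈ N b) (hcard : ∀ a, (N a).card ≤ m) {f : ι → ℝ}
    (hf : ∀ a, 0 ≤ f a) : ∑ a, ∑ b ∈ N a, f b ≤ m * ∑ b, f b := by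
  classical
  have h1 : ∀ a, ∑ b ∈ N a, f b = ∑ b, if b ∈ N a then f b else 0 := fun a => by simp
  simp_rw [h1]
  rw [Finset.sum_comm, Finset.mul_sum]
  refine Finset.sum_le_sum fun b _ => ?_
  have h2 : ∀ a, (if b ∈ N a then f b else 0) ≤ if a ∈ N b then f b else 0 := fun a => by
    by_cases h : b ∈ N a
    · simp [h, hsymm a b h]
    · simp only [h, if_false]
      split_ifs
      exacts [hf b, le_rfl]
  refine (Finset.sum_le_sum fun a _ => h2 a).trans ?_
  rw [Finset.sum_ite_mem, Finset.univ_inter, Finset.sum_const, nsmul_eq_mul]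
  exact mul_le_mul_of_nonneg_right (by exact_mod_cast hcard b) (hf b)

theorem sum_card_neighbours_le {ι : Type*} [Fintype ι] {N : ι → Finset ι} {m : ℕ}
    (hcard : ∀ a, (N a).card ≤ m) {f : ι → ℝ} (hf : ∀ a, 0 ≤ f a) (a : ι) :
    ∑ _b ∈ N a, f a ≤ m * f a := by
  rw [Finset.sum_const, nsmul_eq_mul]
  exact mul_le_mul_of_nonneg_right (by exact_mod_cast hcard a) (hf a)

/-- The total of the error terms in the expansion at each position. -/
theorem sum_expansion_errors_le {ι : Type*} [Fintype ι] {N : ι → Finset ι} {m : ℕ}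
    (hsymm : ∀ a b, b ∈ N a → a ∈ N b) (hcard : ∀ a, (N a).card ≤ m) {r : ι → ℝ}
    (hr : ∀ a, 0 ≤ r a) :
    ∑ a, (4 * ∑ b ∈ N a, ∑ b' ∈ N a, (r a + r b + r b') +
      2 * ∑ b ∈ N a, ∑ b' ∈ N b, (r a + r b + r b')) ≤ 18 * m ^ 2 * ∑ a, r a := by
  have hm : (0 : ℝ) ≤ m := Nat.cast_nonneg m
  have hR : ∀ a, 0 ≤ ∑ b ∈ N a, r b := fun a => Finset.sum_nonneg fun b _ => hr b
  have c1 : ∀ a, ∑ _b ∈ N a, r a ≤ m * r a := sum_card_neighbours_le hcard hr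
  have c2 := sum_sum_neighbours_le hsymm hcard hr
  have inner : ∀ a b c, ∑ b' ∈ N c, (r a + r b + r b') ≤ m * (r a + r b) + ∑ b' ∈ N c, r b' := by
    intro a b c
    rw [Finset.sum_add_distrib, Finset.sum_const, nsmul_eq_mul]
    gcongr
    · exact add_nonneg (hr a) (hr b)
    · exact_mod_cast hcard c
  have o1 : ∀ a, ∑ b ∈ N a, ∑ b' ∈ N a, (r a + r b + r b')
      ≤ m * (m * r a) + 2 * (m * ∑ b ∈ N a, r b) := by
    intro a
    refine (Finset.sum_le_sum fun b _ => inner a b a).trans ?_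
    rw [Finset.sum_add_distrib, ← Finset.mul_sum, Finset.sum_add_distrib]
    have h1 := sum_card_neighbours_le hcard hR a
    have h2 := mul_le_mul_of_nonneg_left (c1 a) hm
    linarith
  have o2 : ∀ a, ∑ b ∈ N a, ∑ b' ∈ N b, (r a + r b + r b')
      ≤ m * (m * r a) + m * ∑ b ∈ N a, r b + ∑ b ∈ N a, ∑ b' ∈ N b, r b' := by
    intro a
    refine (Finset.sum_le_sum fun b _ => inner a b b).trans ?_
    rw [Finset.sum_add_distrib, ← Finset.mul_sum, Finset.sum_add_distrib]
    have h2 := mul_le_mul_of_nonneg_left (c1 a) hm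
    linarith
  have c3 := (sum_sum_neighbours_le hsymm hcard hR).trans (mul_le_mul_of_nonneg_left c2 hm)
  have c4 := mul_le_mul_of_nonneg_left c2 hm
  -- Here 6 = 4 + 2 and 10 = 4·2 + 2. Each of the three kinds of sum is at most m² ∑ r, so the total
  -- constant is 6 + 10 + 2 = 18.
  calc _ ≤ ∑ a, (6 * (m * (m * r a)) + 10 * (m * ∑ b ∈ N a, r b)
        + 2 * ∑ b ∈ N a, ∑ b' ∈ N b, r b') :=
        Finset.sum_le_sum fun a _ => by linarith [o1 a, o2 a]
    _ = 6 * (m * (m * ∑ a, r a)) + 10 * (m * ∑ a, ∑ b ∈ N a, r b)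
        + 2 * ∑ a, ∑ b ∈ N a, ∑ b' ∈ N b, r b' := by
        simp only [Finset.sum_add_distrib, Finset.mul_sum]
    _ ≤ _ := by linarith

/-! ### Expansion of the drift of a centered locally dependent field -/

/-- Centered square-integrable locally dependent laws. -/
structure CenteredField {ι : Type*} (N : ι → Finset ι) (μ : Measure (ι → ℝ)) : Prop where
  memLp : ∀ a, MemLp (fun x : ι → ℝ => x a) 2 μ
  mean : ∀ a, ∫ x, x a ∂μ = 0
  dep : LocallyDependent N μ

section Expansion

variable {ι : Type*} {N : ι → Finset ι} {μ : Measure (ι → ℝ)} {s : ℝ}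

theorem measurable_min_eval (s : ℝ) (a : ι) :
    Measurable fun x : ι → ℝ => min 1 (|x a| / s) := by
  have h : Measurable fun y : ℝ => min 1 (|y| / s) := by fun_prop
  exact h.comp (measurable_pi_apply a)

theorem measurable_ofReal_eval (a : ι) : Measurable fun x : ι → ℝ => (x a : ℂ) :=
  Complex.measurable_ofReal.comp (measurable_pi_apply a)

theorem integrable_lindebergWeight_eval {a : ι} (hs : 0 ≤ s)
    (hμ : MemLp (fun x : ι → ℝ => x a) 2 μ) : Integrable (fun x => lindebergWeight s (x a)) μ := by
  refine hμ.integrable_sq.mono'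
    ((measurable_lindebergWeight s).comp (measurable_pi_apply a)).aestronglyMeasurable
    (Eventually.of_forall fun x => ?_)
  rw [Real.norm_of_nonneg (lindebergWeight_nonneg hs _)]
  exact lindebergWeight_le_sq s _

namespace CenteredField

theorem integrable_lindebergWeight (hs : 0 ≤ s) (hμ : CenteredField N μ) (a : ι) :
    Integrable (fun x => lindebergWeight s (x a)) μ :=
  integrable_lindebergWeight_eval hs (hμ.memLp a)

theorem integrable_mul (hμ : CenteredField N μ) (a b : ι) :
    Integrable (fun x : ι → ℝ => x a * x b) μ := (hμ.memLp a).integrable_mul (hμ.memLp b)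

theorem integrable_abs_mul (hμ : CenteredField N μ) (a b : ι) :
    Integrable (fun x : ι → ℝ => |x a| * |x b|) μ := by
  simpa [abs_mul] using (hμ.integrable_mul a b).abs

theorem integrable_eval [IsProbabilityMeasure μ] (hμ : CenteredField N μ) (a : ι) :
    Integrable (fun x : ι → ℝ => x a) μ := (hμ.memLp a).integrable one_le_two

theorem integrable_min [IsProbabilityMeasure μ] (hs : 0 ≤ s) (a : ι) :
    Integrable (fun x : ι → ℝ => min 1 (|x a| / s)) μ := by
  refine Integrable.of_bound (C := 1) (measurable_min_eval s a).aestronglyMeasurable (Eventually.of_forall fun x => ?_)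
  rw [Real.norm_of_nonneg (by positivity)]
  exact min_le_left _ _

theorem integrable_abs_mul_min (hs : 0 ≤ s) (hμ : CenteredField N μ) (a b b' : ι) :
    Integrable (fun x : ι → ℝ => |x a| * |x b| * min 1 (|x b'| / s)) μ := by
  refine (hμ.integrable_abs_mul a b).mul_bdd (c := 1)
    (measurable_min_eval s b').aestronglyMeasurable
    (Eventually.of_forall fun x => ?_)
  rw [Real.norm_of_nonneg (by positivity)]
  exact min_le_left _ _

theorem integral_abs_mul_min_le (hs : 0 ≤ s) (hμ : CenteredField N μ) (a b b' : ι) :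
    ∫ x, |x a| * |x b| * min 1 (|x b'| / s) ∂μ ≤ ∫ x, lindebergWeight s (x a) ∂μ +
      ∫ x, lindebergWeight s (x b) ∂μ + ∫ x, lindebergWeight s (x b') ∂μ := by
  have h := hμ.integrable_lindebergWeight hs
  have hab : Integrable (fun x => lindebergWeight s (x a) + lindebergWeight s (x b)) μ :=
    (h a).add (h b)
  rw [← integral_add (h a) (h b), ← integral_add hab (h b')]
  exact integral_mono (hμ.integrable_abs_mul_min hs a b b') (((h a).add (h b)).add (h b'))
    fun x => abs_mul_abs_mul_min_le hs _ _ _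

/-- A product of expectations is an expectation over two independent copies, so the pointwise
inequality still applies, with b' read in the second copy. -/
theorem integral_abs_mul_mul_integral_min_le [IsProbabilityMeasure μ] (hs : 0 ≤ s)
    (hμ : CenteredField N μ) (a b b' : ι) :
    (∫ x, |x a| * |x b| ∂μ) * ∫ x, min 1 (|x b'| / s) ∂μ ≤ ∫ x, lindebergWeight s (x a) ∂μ +
      ∫ x, lindebergWeight s (x b) ∂μ + ∫ x, lindebergWeight s (x b') ∂μ := by
  have h := hμ.integrable_lindebergWeight hs
  have hab : Integrable (fun x => lindebergWeight s (x a) + lindebergWeight s (x b)) μ :=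
    (h a).add (h b)
  have h1 : ∀ y : ι → ℝ, (∫ x, |x a| * |x b| ∂μ) * min 1 (|y b'| / s)
      ≤ (∫ x, lindebergWeight s (x a) ∂μ + ∫ x, lindebergWeight s (x b) ∂μ)
        + lindebergWeight s (y b') := by
    intro y
    have h2 : (∫ x, lindebergWeight s (x a) ∂μ + ∫ x, lindebergWeight s (x b) ∂μ)
        + lindebergWeight s (y b')
        = ∫ x, (lindebergWeight s (x a) + lindebergWeight s (x b) + lindebergWeight s (y b')) ∂μ := by
      rw [integral_add hab (integrable_const _), integral_add (h a) (h b)]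
      simp
    rw [h2, ← integral_mul_const]
    exact integral_mono ((hμ.integrable_abs_mul a b).mul_const _)
      (((h a).add (h b)).add (integrable_const _)) fun x => abs_mul_abs_mul_min_le hs _ _ _
  rw [← integral_const_mul]
  refine (integral_mono ((integrable_min hs b').const_mul _) ((integrable_const _).add (h b'))
    h1).trans ?_
  rw [integral_add' (integrable_const _) (h b')]
  simp

end CenteredField

variable [Fintype ι] {F : (ι → ℝ) → ℂ} {ψ : ι → (ι → ℝ) → ℂ}
  {H : ι → ι → (ι → ℝ) → ℂ} {B c : ℝ}

omit [Fintype ι] in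
theorem scaled_eq_compl_add (κ : ℝ) (T : Finset ι) (x y : ι → ℝ) :
    κ • x + y = (κ • (T : Set ι)ᶜ.indicator x + y) + κ • (T : Set ι).indicator x := by
  conv_lhs => rw [← Set.indicator_self_add_compl (T : Set ι) x, smul_add]
  abel

theorem sum_abs_smul_indicator_le {κ : ℝ} (hκ : |κ| ≤ 1) (T : Finset ι) (x : ι → ℝ) :
    ∑ a, |(κ • (T : Set ι).indicator x) a| ≤ ∑ a ∈ T, |x a| := by
  classical
  have h : ∀ a, |(κ • (T : Set ι).indicator x) a| ≤ if a ∈ T then |x a| else 0 := by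
    intro a
    rw [Pi.smul_apply, smul_eq_mul, abs_mul, Set.indicator_apply]
    by_cases ha : a ∈ T
    · simpa [ha] using mul_le_of_le_one_left (abs_nonneg (x a)) hκ
    · simp [ha]
  refine (Finset.sum_le_sum fun a _ => h a).trans (le_of_eq ?_)
  simp

namespace TaylorData

variable [Nonempty ι]

theorem hess_compl_le (hs : 0 ≤ s) (h : TaylorData F ψ H B c s) {κ : ℝ} (hκ : |κ| ≤ 1)
    (T : Finset ι) (a b : ι) (x y : ι → ℝ) :
    ‖H a b (κ • x + y) - H a b (κ • (T : Set ι)ᶜ.indicator x + y)‖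
      ≤ c * ∑ b' ∈ T, min 1 (|x b'| / s) := by
  rw [scaled_eq_compl_add κ T x y]
  refine (h.hess_sub _ _ _ _).trans (mul_le_mul_of_nonneg_left ?_ h.coeff_nonneg)
  refine le_trans ?_ (min_one_sum_div_le hs T x)
  gcongr
  exact sum_abs_smul_indicator_le hκ T x

/-- The Taylor expansion is centered at the field with T deleted, so that the coefficients H do not
involve the coordinates in T. -/
theorem grad_compl_le (hs : 0 ≤ s) (h : TaylorData F ψ H B c s) {κ : ℝ} (hκ : |κ| ≤ 1)
    (T : Finset ι) (a : ι) (x y : ι → ℝ) :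
    ‖ψ a (κ • x + y) - ψ a (κ • (T : Set ι)ᶜ.indicator x + y) -
      κ * ∑ b ∈ T, (x b : ℂ) * H a b (κ • (T : Set ι)ᶜ.indicator x + y)‖
      ≤ c * ∑ b ∈ T, ∑ b' ∈ T, |x b| * min 1 (|x b'| / s) := by
  classical
  have e : (κ : ℂ) * ∑ b ∈ T, (x b : ℂ) * H a b (κ • (T : Set ι)ᶜ.indicator x + y)
      = ∑ b, (((κ • (T : Set ι).indicator x) b : ℝ) : ℂ) *
        H a b (κ • (T : Set ι)ᶜ.indicator x + y) := by
    have : ∀ b, (((κ • (T : Set ι).indicator x) b : ℝ) : ℂ) *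
        H a b (κ • (T : Set ι)ᶜ.indicator x + y)
        = if b ∈ T then κ * ((x b : ℂ) * H a b (κ • (T : Set ι)ᶜ.indicator x + y)) else 0 := by
      intro b
      rw [Pi.smul_apply, smul_eq_mul, Set.indicator_apply]
      by_cases hb : b ∈ T
      · simp [hb, mul_assoc]
      · simp [hb]
    simp_rw [this]
    rw [Finset.sum_ite_mem, Finset.univ_inter, Finset.mul_sum]
  rw [e]
  conv_lhs => enter [1, 1, 1]; rw [scaled_eq_compl_add κ T x y]
  refine (h.grad_taylor _ _ _).trans ?_
  rw [mul_assoc]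
  refine mul_le_mul_of_nonneg_left ?_ h.coeff_nonneg
  have h1 := sum_abs_smul_indicator_le hκ T x
  have h2 := min_one_sum_div_le hs T x
  have h3 : 0 ≤ ∑ a, |(κ • (T : Set ι).indicator x) a| := sum_abs_nonneg _
  rw [← Finset.sum_mul_sum]
  refine mul_le_mul h1 (le_trans ?_ h2) (by positivity)
    (Finset.sum_nonneg fun _ _ => abs_nonneg _)
  gcongr

end TaylorData

variable [IsProbabilityMeasure μ] [Nonempty ι]

omit [Fintype ι] [Nonempty ι] in
theorem measurable_scaled (κ : ℝ) (S : Set ι) (y : ι → ℝ) :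
    Measurable fun x : ι → ℝ => κ • S.indicator x + y :=
  ((measurable_indicator_pi S).const_smul κ).add_const y

namespace CenteredField

omit [IsProbabilityMeasure μ] in
-- With N a deleted, the gradient is a function of coordinates independent of the centered variable
-- x a.
theorem integral_mul_grad_compl_eq_zero (hμ : CenteredField N μ) (h : TaylorData F ψ H B c s)
    (a : ι) (κ : ℝ) (y : ι → ℝ) :
    ∫ x, (x a : ℂ) * ψ a (κ • (N a : Set ι)ᶜ.indicator x + y) ∂μ = 0 := by
  have hi := hμ.dep {a} (N a : Set ι)ᶜ (by rintro a' rfl b hb; simpa using hb)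
  have hi2 : IndepFun (fun x : ι → ℝ => (x a : ℂ))
      (fun x => ψ a (κ • (N a : Set ι)ᶜ.indicator x + y)) μ := by
    have := hi.comp (φ := fun x : ι → ℝ => (x a : ℂ)) (ψ := fun x => ψ a (κ • x + y))
      (by fun_prop) ((h.continuous_grad a).measurable.comp (by fun_prop))
    simpa [Function.comp_def] using this
  rw [hi2.integral_fun_mul_eq_mul_integral (measurable_ofReal_eval a).aestronglyMeasurable
    ((h.continuous_grad a).measurable.comp (measurable_scaled κ _ y)).aestronglyMeasurable,
    integral_complex_ofReal, hμ.mean a]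
  simp

omit [IsProbabilityMeasure μ] in
-- T must contain both neighbourhoods for the pair (x a, x b) to be independent of the coordinates
-- off T.
theorem integral_mul_hess_compl (hμ : CenteredField N μ) (h : TaylorData F ψ H B c s)
    (a b : ι) (T : Finset ι) (hTa : N a ⊆ T) (hTb : N b ⊆ T) (κ : ℝ) (y : ι → ℝ) :
    ∫ x, (x a * x b : ℂ) * H a b (κ • (T : Set ι)ᶜ.indicator x + y) ∂μ
      = (∫ x, (x a * x b : ℂ) ∂μ) * ∫ x, H a b (κ • (T : Set ι)ᶜ.indicator x + y) ∂μ := by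
  have hi := hμ.dep {a, b} (T : Set ι)ᶜ (by
    rintro a' (rfl | rfl) b' hb'
    · exact fun h => hb' (hTa h)
    · exact fun h => hb' (hTb h))
  have hi2 : IndepFun (fun x : ι → ℝ => (x a * x b : ℂ))
      (fun x => H a b (κ • (T : Set ι)ᶜ.indicator x + y)) μ := by
    have := hi.comp (φ := fun x : ι → ℝ => (x a * x b : ℂ)) (ψ := fun x => H a b (κ • x + y))
      (by fun_prop) ((h.continuous_hess a b).measurable.comp (by fun_prop))
    simpa [Function.comp_def] using this
  exact hi2.integral_fun_mul_eq_mul_integral (by fun_prop)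
    ((h.continuous_hess a b).measurable.comp (measurable_scaled κ _ y)).aestronglyMeasurable

omit [Fintype ι] [IsProbabilityMeasure μ] [Nonempty ι] in
theorem integral_mul_eq_zero (hμ : CenteredField N μ) {a b : ι} (hb : b ∉ N a) :
    ∫ x, (x a * x b : ℂ) ∂μ = 0 := by
  have hi := hμ.dep {a} {b} (by rintro a' rfl b' rfl; exact hb)
  have hi2 : IndepFun (fun x : ι → ℝ => (x a : ℂ)) (fun x => (x b : ℂ)) μ := by
    have := hi.comp (φ := fun x : ι → ℝ => (x a : ℂ)) (ψ := fun x : ι → ℝ => (x b : ℂ))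
      (by fun_prop) (by fun_prop)
    simpa [Function.comp_def] using this
  rw [hi2.integral_fun_mul_eq_mul_integral (measurable_ofReal_eval a).aestronglyMeasurable
    (measurable_ofReal_eval b).aestronglyMeasurable,
    integral_complex_ofReal, hμ.mean a]
  simp

theorem integrable_hess (h : TaylorData F ψ H B c s) (a b : ι) (κ : ℝ) (S : Set ι) (y : ι → ℝ) :
    Integrable (fun x => H a b (κ • S.indicator x + y)) μ :=
  Integrable.of_bound (C := c)
    ((h.continuous_hess a b).measurable.comp (measurable_scaled κ S y)).aestronglyMeasurable
    (Eventually.of_forall fun _ => h.hess_bound _ _ _)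

omit [IsProbabilityMeasure μ] in
theorem integrable_mul_hess (hμ : CenteredField N μ) (h : TaylorData F ψ H B c s) (a b : ι) (κ : ℝ)
    (S : Set ι) (y : ι → ℝ) :
    Integrable (fun x : ι → ℝ => (x a * x b : ℂ) * H a b (κ • S.indicator x + y)) μ := by
  refine Integrable.mul_bdd (c := c) ?_
    ((h.continuous_hess a b).measurable.comp (measurable_scaled κ S y)).aestronglyMeasurable
    (Eventually.of_forall fun _ => h.hess_bound _ _ _)
  simpa using (hμ.integrable_mul a b).ofReal (𝕜 := ℂ)

theorem integrable_mul_grad (hμ : CenteredField N μ) (h : TaylorData F ψ H B c s) (a : ι) (κ : ℝ)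
    (S : Set ι) (y : ι → ℝ) :
    Integrable (fun x : ι → ℝ => (x a : ℂ) * ψ a (κ • S.indicator x + y)) μ :=
  Integrable.mul_bdd (c := B) (hμ.integrable_eval a).ofReal
    ((h.continuous_grad a).measurable.comp (measurable_scaled κ S y)).aestronglyMeasurable
    (Eventually.of_forall fun _ => h.grad_bound _ _)

/-- Enlarge the deleted set from N a to T = N a ∪ N b, factor the expectation, then put T back
inside the Hessian. The first move costs 2 sums over N a and 1 over N b, the last costs one of each;
hence 3 and 2. -/
theorem norm_hess_term_le (hs : 0 ≤ s) (hμ : CenteredField N μ) (h : TaylorData F ψ H B c s)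
    (a b : ι) {κ : ℝ} (hκ : |κ| ≤ 1) (y : ι → ℝ) :
    ‖∫ x, (x a * x b : ℂ) * H a b (κ • (N a : Set ι)ᶜ.indicator x + y) ∂μ
      - (∫ x, (x a * x b : ℂ) ∂μ) * ∫ x, H a b (κ • x + y) ∂μ‖ ≤
    c * (3 * ∑ b' ∈ N a, (∫ x, lindebergWeight s (x a) ∂μ + ∫ x, lindebergWeight s (x b) ∂μ +
        ∫ x, lindebergWeight s (x b') ∂μ) +
      2 * ∑ b' ∈ N b, (∫ x, lindebergWeight s (x a) ∂μ + ∫ x, lindebergWeight s (x b) ∂μ +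
        ∫ x, lindebergWeight s (x b') ∂μ)) := by
  classical
  set T := N a ∪ N b with hT
  have hc := h.coeff_nonneg
  have hsplit : ∀ f : ι → ℝ, (∀ b, 0 ≤ f b) → ∑ b' ∈ T, f b' ≤ ∑ b' ∈ N a, f b' + ∑ b' ∈ N b, f b' :=
    fun f hf => by
      rw [← Finset.sum_union_inter]
      exact le_add_of_nonneg_right (Finset.sum_nonneg fun _ _ => hf _)
  have hw : ∀ (x : ι → ℝ) (b : ι), 0 ≤ min 1 (|x b| / s) := fun x b => by positivity
  have hH : ∀ κ y, Integrable (fun x => H a b (κ • x + y)) μ := fun κ y => by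
    simpa using integrable_hess h a b κ Set.univ y
  have i1 := hμ.integrable_abs_mul_min hs a b
  have e1 : ‖∫ x, (x a * x b : ℂ) * H a b (κ • (N a : Set ι)ᶜ.indicator x + y) ∂μ
      - ∫ x, (x a * x b : ℂ) * H a b (κ • (T : Set ι)ᶜ.indicator x + y) ∂μ‖ ≤
      ∫ x, c * (2 * ∑ b' ∈ N a, |x a| * |x b| * min 1 (|x b'| / s)
        + ∑ b' ∈ N b, |x a| * |x b| * min 1 (|x b'| / s)) ∂μ := by
    rw [← integral_sub (hμ.integrable_mul_hess h a b κ _ y) (hμ.integrable_mul_hess h a b κ _ y)]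
    refine norm_integral_le_of_norm_le ?_ (Eventually.of_forall fun x => ?_)
    · exact (((integrable_finsetSum _ fun b' _ => i1 b').const_mul 2).add
        (integrable_finsetSum _ fun b' _ => i1 b')).const_mul c
    · have h1 := h.hess_compl_le hs hκ (N a) a b x y
      have h2 := h.hess_compl_le hs hκ T a b x y
      have h3 := hsplit _ (hw x)
      have h4 : ‖H a b (κ • (N a : Set ι)ᶜ.indicator x + y)
          - H a b (κ • (T : Set ι)ᶜ.indicator x + y)‖ ≤ c * (2 * ∑ b' ∈ N a, min 1 (|x b'| / s)
            + ∑ b' ∈ N b, min 1 (|x b'| / s)) := by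
        -- Both deleted fields are compared with the full field, which is why N a is counted twice.
        rw [← sub_sub_sub_cancel_left _ _ (H a b (κ • x + y))]
        refine (norm_sub_le _ _).trans ((add_le_add h2 h1).trans ?_)
        rw [← mul_add]
        exact mul_le_mul_of_nonneg_left (by linarith) hc
      rw [← mul_sub, norm_mul, norm_mul, Complex.norm_real, Complex.norm_real, Real.norm_eq_abs,
        Real.norm_eq_abs]
      refine (mul_le_mul_of_nonneg_left h4 (by positivity)).trans (le_of_eq ?_)
      simp only [← Finset.mul_sum]
      ring
  have e2 : ‖(∫ x, (x a * x b : ℂ) ∂μ) * ∫ x, H a b (κ • (T : Set ι)ᶜ.indicator x + y) ∂μ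
      - (∫ x, (x a * x b : ℂ) ∂μ) * ∫ x, H a b (κ • x + y) ∂μ‖ ≤
      (∫ x, |x a| * |x b| ∂μ) * ∫ x, c * (∑ b' ∈ N a, min 1 (|x b'| / s)
        + ∑ b' ∈ N b, min 1 (|x b'| / s)) ∂μ := by
    rw [← mul_sub, norm_mul, ← integral_sub (integrable_hess h a b κ _ y) (hH κ y)]
    refine mul_le_mul ?_ ?_ (norm_nonneg _)
      (integral_nonneg fun x => mul_nonneg (abs_nonneg _) (abs_nonneg _))
    · refine norm_integral_le_of_norm_le (hμ.integrable_abs_mul a b)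
        (Eventually.of_forall fun x => ?_)
      simp
    · refine norm_integral_le_of_norm_le ?_ (Eventually.of_forall fun x => ?_)
      · exact ((integrable_finsetSum _ fun b' _ => integrable_min hs b').add
          (integrable_finsetSum _ fun b' _ => integrable_min hs b')).const_mul c
      · rw [norm_sub_rev]
        exact (h.hess_compl_le hs hκ T a b x y).trans
          (mul_le_mul_of_nonneg_left (hsplit _ (hw x)) hc)
  rw [← hμ.integral_mul_hess_compl h a b T Finset.subset_union_left Finset.subset_union_right] at e2
  rw [integral_const_mul, integral_add ((integrable_finsetSum _ fun b' _ => i1 b').const_mul 2)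
    (integrable_finsetSum _ fun b' _ => i1 b'), integral_const_mul,
    integral_finsetSum _ fun b' _ => i1 b', integral_finsetSum _ fun b' _ => i1 b'] at e1
  rw [integral_const_mul, integral_add (integrable_finsetSum _ fun b' _ => integrable_min hs b')
    (integrable_finsetSum _ fun b' _ => integrable_min hs b'),
    integral_finsetSum _ fun b' _ => integrable_min hs b',
    integral_finsetSum _ fun b' _ => integrable_min hs b', mul_left_comm, mul_add,
    Finset.mul_sum, Finset.mul_sum] at e2
  refine (norm_sub_le_norm_sub_add_norm_sub _ _ _).trans ((add_le_add e1 e2).trans ?_)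
  rw [← mul_add]
  refine mul_le_mul_of_nonneg_left ?_ hc
  have f1 : ∀ c, ∑ b' ∈ N c, ∫ x, |x a| * |x b| * min 1 (|x b'| / s) ∂μ ≤ _ := fun c =>
    Finset.sum_le_sum fun b' _ => hμ.integral_abs_mul_min_le hs a b b'
  have f2 : ∀ c, ∑ b' ∈ N c, (∫ x, |x a| * |x b| ∂μ) * ∫ x, min 1 (|x b'| / s) ∂μ ≤ _ := fun c =>
    Finset.sum_le_sum fun b' _ => hμ.integral_abs_mul_mul_integral_min_le hs a b b'
  linarith [f1 a, f1 b, f2 a, f2 b]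

/-- The drift of a centered locally dependent field in the direction of the coordinate `a`. -/
theorem norm_drift_sub_le (hs : 0 ≤ s) (hμ : CenteredField N μ) (h : TaylorData F ψ H B c s)
    (a : ι) {κ : ℝ} (hκ : |κ| ≤ 1) (y : ι → ℝ) :
    ‖∫ x, (x a : ℂ) * ψ a (κ • x + y) ∂μ
      - κ * ∑ b, (∫ x, (x a * x b : ℂ) ∂μ) * ∫ x, H a b (κ • x + y) ∂μ‖ ≤
    c * (4 * ∑ b ∈ N a, ∑ b' ∈ N a, (∫ x, lindebergWeight s (x a) ∂μ +
        ∫ x, lindebergWeight s (x b) ∂μ + ∫ x, lindebergWeight s (x b') ∂μ) +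
      2 * ∑ b ∈ N a, ∑ b' ∈ N b, (∫ x, lindebergWeight s (x a) ∂μ +
        ∫ x, lindebergWeight s (x b) ∂μ + ∫ x, lindebergWeight s (x b') ∂μ)) := by
  have hc := h.coeff_nonneg
  have i1 := hμ.integrable_abs_mul_min hs a
  have hsum : ∑ b, (∫ x, (x a * x b : ℂ) ∂μ) * ∫ x, H a b (κ • x + y) ∂μ
      = ∑ b ∈ N a, (∫ x, (x a * x b : ℂ) ∂μ) * ∫ x, H a b (κ • x + y) ∂μ := by
    refine (Finset.sum_subset (Finset.subset_univ _) fun b _ hb => ?_).symm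
    rw [hμ.integral_mul_eq_zero hb, zero_mul]
  have hψ : Integrable (fun x : ι → ℝ => (x a : ℂ) * ψ a (κ • x + y)) μ := by
    simpa using hμ.integrable_mul_grad h a κ Set.univ y
  have hψ' := hμ.integrable_mul_grad h a κ (N a : Set ι)ᶜ y
  have hH := fun b => hμ.integrable_mul_hess h a b κ (N a : Set ι)ᶜ y
  -- First-order Taylor expansion of the gradient in the coordinates of N a; its zeroth-order term
  -- integrates to zero.
  have e1 : ‖∫ x, (x a : ℂ) * ψ a (κ • x + y) ∂μ
      - κ * ∑ b ∈ N a, ∫ x, (x a * x b : ℂ) * H a b (κ • (N a : Set ι)ᶜ.indicator x + y) ∂μ‖ ≤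
      ∫ x, c * ∑ b ∈ N a, ∑ b' ∈ N a, |x a| * |x b| * min 1 (|x b'| / s) ∂μ := by
    have e0 : ∫ x, (x a : ℂ) * ψ a (κ • x + y) ∂μ
      - κ * ∑ b ∈ N a, ∫ x, (x a * x b : ℂ) * H a b (κ • (N a : Set ι)ᶜ.indicator x + y) ∂μ
      = ∫ x, (x a : ℂ) * ψ a (κ • x + y) - (x a : ℂ) * ψ a (κ • (N a : Set ι)ᶜ.indicator x + y)
        - κ * ∑ b ∈ N a, (x a * x b : ℂ) * H a b (κ • (N a : Set ι)ᶜ.indicator x + y) ∂μ := by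
      have hd : Integrable (fun x : ι → ℝ => (x a : ℂ) * ψ a (κ • x + y)
          - (x a : ℂ) * ψ a (κ • (N a : Set ι)ᶜ.indicator x + y)) μ := hψ.sub hψ'
      rw [integral_sub hd ((integrable_finsetSum _ fun b _ => hH b).const_mul _),
        integral_sub hψ hψ', hμ.integral_mul_grad_compl_eq_zero h, sub_zero, integral_const_mul,
        integral_finsetSum _ fun b _ => hH b]
    rw [e0]
    refine norm_integral_le_of_norm_le ?_ (Eventually.of_forall fun x => ?_)
    · exact (integrable_finsetSum _ fun b _ => integrable_finsetSum _ fun b' _ =>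
        i1 b b').const_mul c
    · have h1 := h.grad_compl_le hs hκ (N a) a x y
      have e3 : (x a : ℂ) * ψ a (κ • x + y)
          - (x a : ℂ) * ψ a (κ • (N a : Set ι)ᶜ.indicator x + y)
          - κ * ∑ b ∈ N a, (x a * x b : ℂ) * H a b (κ • (N a : Set ι)ᶜ.indicator x + y)
          = (x a : ℂ) * (ψ a (κ • x + y) - ψ a (κ • (N a : Set ι)ᶜ.indicator x + y)
          - κ * ∑ b ∈ N a, (x b : ℂ) * H a b (κ • (N a : Set ι)ᶜ.indicator x + y)) := by
        simp only [mul_sub, mul_assoc, ← Finset.mul_sum]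
        ring
      rw [e3, norm_mul, Complex.norm_real, Real.norm_eq_abs]
      refine (mul_le_mul_of_nonneg_left h1 (abs_nonneg _)).trans (le_of_eq ?_)
      simp only [mul_assoc, ← Finset.mul_sum]
      ring
  -- Decoupling of x a * x b from the Hessian. Its coefficient 3 and the coefficient 1 of `e1` give
  -- the final 4.
  have e2 : ‖κ * ∑ b ∈ N a, ∫ x, (x a * x b : ℂ) * H a b (κ • (N a : Set ι)ᶜ.indicator x + y) ∂μ
      - κ * ∑ b ∈ N a, (∫ x, (x a * x b : ℂ) ∂μ) * ∫ x, H a b (κ • x + y) ∂μ‖ ≤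
      ∑ b ∈ N a, c * (3 * ∑ b' ∈ N a, (∫ x, lindebergWeight s (x a) ∂μ +
        ∫ x, lindebergWeight s (x b) ∂μ + ∫ x, lindebergWeight s (x b') ∂μ) +
      2 * ∑ b' ∈ N b, (∫ x, lindebergWeight s (x a) ∂μ + ∫ x, lindebergWeight s (x b) ∂μ +
        ∫ x, lindebergWeight s (x b') ∂μ)) := by
    rw [← mul_sub, norm_mul, Complex.norm_real, Real.norm_eq_abs, ← Finset.sum_sub_distrib]
    refine (mul_le_of_le_one_left (norm_nonneg _) hκ).trans ?_
    exact (norm_sum_le _ _).trans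
      (Finset.sum_le_sum fun b _ => hμ.norm_hess_term_le hs h a b hκ y)
  rw [hsum]
  refine (norm_sub_le_norm_sub_add_norm_sub _ _ _).trans ((add_le_add e1 e2).trans ?_)
  rw [integral_const_mul, integral_finsetSum _ fun b _ => integrable_finsetSum _ fun b' _ =>
    i1 b b', ← Finset.mul_sum, ← mul_add]
  refine mul_le_mul_of_nonneg_left ?_ hc
  rw [Finset.sum_add_distrib, ← Finset.mul_sum, ← Finset.mul_sum]
  have f1 : ∑ b ∈ N a, ∫ x, ∑ b' ∈ N a, |x a| * |x b| * min 1 (|x b'| / s) ∂μ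
      ≤ ∑ b ∈ N a, ∑ b' ∈ N a, (∫ x, lindebergWeight s (x a) ∂μ +
        ∫ x, lindebergWeight s (x b) ∂μ + ∫ x, lindebergWeight s (x b') ∂μ) := by
    refine Finset.sum_le_sum fun b _ => ?_
    rw [integral_finsetSum _ fun b' _ => i1 b b']
    exact Finset.sum_le_sum fun b' _ => hμ.integral_abs_mul_min_le hs a b b'
  linarith

end CenteredField

end Expansion

/-! ### Comparison of two locally dependent fields with the same covariances -/

section Comparison

variable {ι : Type*} [Fintype ι] [Nonempty ι] {N : ι → Finset ι} {m : ℕ} {μ ν : Measure (ι → ℝ)}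
  [IsProbabilityMeasure μ] [IsProbabilityMeasure ν] {F : (ι → ℝ) → ℂ} {ψ : ι → (ι → ℝ) → ℂ}
  {H : ι → ι → (ι → ℝ) → ℂ} {B c s : ℝ}

omit [Fintype ι] [Nonempty ι] in
theorem measurable_scaled_prod (κ l : ℝ) :
    Measurable fun p : (ι → ℝ) × (ι → ℝ) => κ • p.1 + l • p.2 := by fun_prop

theorem norm_sum_drift_sub_le (hs : 0 ≤ s) (hsymm : ∀ a b, b ∈ N a → a ∈ N b)
    (hcard : ∀ a, (N a).card ≤ m) (hμ : CenteredField N μ) (h : TaylorData F ψ H B c s)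
    {κ : ℝ} (hκ : |κ| ≤ 1) (y : ι → ℝ) :
    ‖∑ a, (∫ x, (x a : ℂ) * ψ a (κ • x + y) ∂μ
      - κ * ∑ b, (∫ x, (x a * x b : ℂ) ∂μ) * ∫ x, H a b (κ • x + y) ∂μ)‖ ≤
    c * (18 * m ^ 2 * ∑ a, ∫ x, lindebergWeight s (x a) ∂μ) := by
  refine (norm_sum_le _ _).trans ((Finset.sum_le_sum fun a _ =>
    hμ.norm_drift_sub_le hs h a hκ y).trans ?_)
  rw [← Finset.mul_sum]
  exact mul_le_mul_of_nonneg_left (sum_expansion_errors_le hsymm hcard fun a =>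
    integral_nonneg fun x => lindebergWeight_nonneg hs _) h.coeff_nonneg

theorem integrable_fst_mul_grad (hμ : CenteredField N μ) (h : TaylorData F ψ H B c s) (a : ι)
    (κ l : ℝ) : Integrable (fun p : (ι → ℝ) × (ι → ℝ) => (p.1 a : ℂ) * ψ a (κ • p.1 + l • p.2))
      (μ.prod ν) := by
  have h1 : Integrable (fun x : ι → ℝ => (x a : ℂ)) μ := (hμ.integrable_eval a).ofReal
  exact Integrable.mul_bdd (c := B) (h1.comp_fst ν)
    ((h.continuous_grad a).measurable.comp (measurable_scaled_prod κ l)).aestronglyMeasurable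
    (Eventually.of_forall fun _ => h.grad_bound _ _)

theorem integrable_hess_prod (h : TaylorData F ψ H B c s) (a b : ι)
    (κ l : ℝ) : Integrable (fun p : (ι → ℝ) × (ι → ℝ) => H a b (κ • p.1 + l • p.2)) (μ.prod ν) :=
  Integrable.of_bound (C := c)
    ((h.continuous_hess a b).measurable.comp (measurable_scaled_prod κ l)).aestronglyMeasurable
    (Eventually.of_forall fun _ => h.hess_bound _ _ _)

/-- The estimate for a fixed shift y is uniform in y, so Fubini averages it over an independent
second field. -/
theorem norm_prod_drift_sub_le (hs : 0 ≤ s) (hsymm : ∀ a b, b ∈ N a → a ∈ N b)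
    (hcard : ∀ a, (N a).card ≤ m) (hμ : CenteredField N μ) (h : TaylorData F ψ H B c s)
    {κ : ℝ} (hκ : |κ| ≤ 1) (l : ℝ) :
    ‖∑ a, (∫ p, (p.1 a : ℂ) * ψ a (κ • p.1 + l • p.2) ∂(μ.prod ν)
      - κ * ∑ b, (∫ x, (x a * x b : ℂ) ∂μ) * ∫ p, H a b (κ • p.1 + l • p.2) ∂(μ.prod ν))‖ ≤
    c * (18 * m ^ 2 * ∑ a, ∫ x, lindebergWeight s (x a) ∂μ) := by
  have i1 := fun a => (integrable_fst_mul_grad (ν := ν) hμ h a κ l)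
  have i2 := fun a b => (integrable_hess_prod (μ := μ) (ν := ν) h a b κ l)
  have e : ∑ a, (∫ p, (p.1 a : ℂ) * ψ a (κ • p.1 + l • p.2) ∂(μ.prod ν)
      - κ * ∑ b, (∫ x, (x a * x b : ℂ) ∂μ) * ∫ p, H a b (κ • p.1 + l • p.2) ∂(μ.prod ν))
      = ∫ y, ∑ a, (∫ x, (x a : ℂ) * ψ a (κ • x + l • y) ∂μ
      - κ * ∑ b, (∫ x, (x a * x b : ℂ) ∂μ) * ∫ x, H a b (κ • x + l • y) ∂μ) ∂ν := by
    have j1 : ∀ a, Integrable (fun y => ∫ x, (x a : ℂ) * ψ a (κ • x + l • y) ∂μ) ν :=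
      fun a => (i1 a).integral_prod_right
    have j2 : ∀ a b, Integrable (fun y => (∫ x, (x a * x b : ℂ) ∂μ) *
        ∫ x, H a b (κ • x + l • y) ∂μ) ν :=
      fun a b => ((i2 a b).integral_prod_right).const_mul _
    have j3 : ∀ a, Integrable (fun y => κ * ∑ b, (∫ x, (x a * x b : ℂ) ∂μ) *
        ∫ x, H a b (κ • x + l • y) ∂μ) ν :=
      fun a => (integrable_finsetSum Finset.univ fun b _ => j2 a b).const_mul (κ : ℂ)
    have j4 : ∀ a ∈ Finset.univ, Integrable (fun y => ∫ x, (x a : ℂ) * ψ a (κ • x + l • y) ∂μ -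
        κ * ∑ b, (∫ x, (x a * x b : ℂ) ∂μ) * ∫ x, H a b (κ • x + l • y) ∂μ) ν :=
      fun a _ => (j1 a).sub (j3 a)
    rw [integral_finsetSum _ j4]
    refine Finset.sum_congr rfl fun a _ => ?_
    rw [integral_sub (j1 a) (j3 a), integral_const_mul, integral_finsetSum _ fun b _ => j2 a b,
      integral_prod_symm _ (i1 a)]
    congr 2
    refine Finset.sum_congr rfl fun b _ => ?_
    rw [integral_const_mul, integral_prod_symm _ (i2 a b)]
  rw [e]
  refine (norm_integral_le_of_norm_le_const (C := c * (18 * m ^ 2 *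
    ∑ a, ∫ x, lindebergWeight s (x a) ∂μ)) (Eventually.of_forall fun y => ?_)).trans (by simp)
  exact norm_sum_drift_sub_le hs hsymm hcard hμ h hκ _

omit [Nonempty ι] in
theorem hasDerivAt_rotation (x y : ι → ℝ) (θ : ℝ) :
    HasDerivAt (fun θ : ℝ => Real.cos θ • x + Real.sin θ • y)
      (-Real.sin θ • x + Real.cos θ • y) θ :=
  ((Real.hasDerivAt_cos θ).smul_const x).add ((Real.hasDerivAt_sin θ).smul_const y)

omit [Nonempty ι] in
theorem hasDerivAt_comp_rotation (h : TaylorData F ψ H B c s) (x y : ι → ℝ) (θ : ℝ) :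
    HasDerivAt (fun θ : ℝ => F (Real.cos θ • x + Real.sin θ • y))
      (∑ a, ((-Real.sin θ * x a + Real.cos θ * y a : ℝ) : ℂ) *
        ψ a (Real.cos θ • x + Real.sin θ • y)) θ := by
  have := (h.hasFDerivAt (Real.cos θ • x + Real.sin θ • y)).comp_hasDerivAt θ
    (hasDerivAt_rotation x y θ)
  simpa [Function.comp_def] using this

theorem hasDerivAt_integral_rotation (hμ : CenteredField N μ) (hν : CenteredField N ν)
    (h : TaylorData F ψ H B c s) (θ : ℝ) :
    HasDerivAt (fun θ : ℝ => ∫ p, F (Real.cos θ • p.1 + Real.sin θ • p.2) ∂(μ.prod ν))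
      (∫ p, ∑ a, ((-Real.sin θ * p.1 a + Real.cos θ * p.2 a : ℝ) : ℂ) *
        ψ a (Real.cos θ • p.1 + Real.sin θ • p.2) ∂(μ.prod ν)) θ := by
  have hψ : ∀ a, Measurable fun p : (ι → ℝ) × (ι → ℝ) =>
      ψ a (Real.cos θ • p.1 + Real.sin θ • p.2) := fun a =>
    (h.continuous_grad a).measurable.comp (measurable_scaled_prod _ _)
  have hF : ∀ θ : ℝ, Measurable fun p : (ι → ℝ) × (ι → ℝ) =>
      F (Real.cos θ • p.1 + Real.sin θ • p.2) := fun θ =>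
    h.continuous.measurable.comp (measurable_scaled_prod _ _)
  refine (hasDerivAt_integral_of_dominated_loc_of_deriv_le (μ := μ.prod ν) (s := Set.univ)
    (F := fun θ (p : (ι → ℝ) × (ι → ℝ)) => F (Real.cos θ • p.1 + Real.sin θ • p.2))
    (F' := fun θ (p : (ι → ℝ) × (ι → ℝ)) =>
      ∑ a, ((-Real.sin θ * p.1 a + Real.cos θ * p.2 a : ℝ) : ℂ) *
        ψ a (Real.cos θ • p.1 + Real.sin θ • p.2))
    (bound := fun p => ∑ a, (|p.1 a| + |p.2 a|) * B) Filter.univ_mem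
    (Eventually.of_forall fun θ => (hF θ).aestronglyMeasurable) ?_ ?_ ?_ ?_ ?_).2
  · exact Integrable.of_bound (C := B) (hF θ).aestronglyMeasurable
      (Eventually.of_forall fun _ => h.bound _)
  · refine (Finset.measurable_sum _ fun a _ => Measurable.mul ?_ (hψ a)).aestronglyMeasurable
    refine Complex.measurable_ofReal.comp ?_
    fun_prop
  · refine Eventually.of_forall fun p θ _ => (norm_sum_le _ _).trans
      (Finset.sum_le_sum fun a _ => ?_)
    rw [norm_mul, Complex.norm_real, Real.norm_eq_abs]
    refine mul_le_mul ?_ (h.grad_bound _ _) (norm_nonneg _) (by positivity)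
    refine (abs_add_le _ _).trans (add_le_add ?_ ?_)
    · rw [abs_mul, abs_neg]
      exact mul_le_of_le_one_left (abs_nonneg _) (Real.abs_sin_le_one θ)
    · rw [abs_mul]
      exact mul_le_of_le_one_left (abs_nonneg _) (Real.abs_cos_le_one θ)
  · exact integrable_finsetSum _ fun a _ => (((hμ.integrable_eval a).abs.comp_fst ν).add
      ((hν.integrable_eval a).abs.comp_snd μ)).mul_const B
  · exact Eventually.of_forall fun p θ _ => hasDerivAt_comp_rotation h p.1 p.2 θ

/-- The drift of μ enters with weight -sin θ and leading term cos θ ∑ Cov·E[H]; that of ν enters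
with weight cos θ and leading term sin θ ∑ Cov·E[H]. Equal covariances make these cancel, and only
the two expansion errors remain. -/
theorem norm_integral_rotation_deriv_le (hs : 0 ≤ s) (hsymm : ∀ a b, b ∈ N a → a ∈ N b)
    (hcard : ∀ a, (N a).card ≤ m) (hμ : CenteredField N μ) (hν : CenteredField N ν)
    (hcov : ∀ a b, ∫ x, x a * x b ∂μ = ∫ x, x a * x b ∂ν) (h : TaylorData F ψ H B c s) (θ : ℝ) :
    ‖∫ p, ∑ a, ((-Real.sin θ * p.1 a + Real.cos θ * p.2 a : ℝ) : ℂ) *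
        ψ a (Real.cos θ • p.1 + Real.sin θ • p.2) ∂(μ.prod ν)‖ ≤
    c * (18 * m ^ 2 * ∑ a, (∫ x, lindebergWeight s (x a) ∂μ + ∫ x, lindebergWeight s (x a) ∂ν)) := by
  have h1 := norm_prod_drift_sub_le (ν := ν) hs hsymm hcard hμ h (Real.abs_cos_le_one θ)
    (Real.sin θ)
  have h2 := norm_prod_drift_sub_le (ν := μ) hs hsymm hcard hν h (Real.abs_sin_le_one θ)
    (Real.cos θ)
  have i1 := fun a => integrable_fst_mul_grad (ν := ν) hμ h a (Real.cos θ) (Real.sin θ)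
  have i2 := fun a => (integrable_fst_mul_grad (ν := μ) hν h a (Real.sin θ) (Real.cos θ)).swap
  have hsw : ∀ x y : ι → ℝ, Real.sin θ • x + Real.cos θ • y = Real.cos θ • y + Real.sin θ • x :=
    fun x y => add_comm _ _
  have s1 : ∀ a, ∫ p, (p.1 a : ℂ) * ψ a (Real.sin θ • p.1 + Real.cos θ • p.2) ∂(ν.prod μ)
      = ∫ p, (p.2 a : ℂ) * ψ a (Real.cos θ • p.1 + Real.sin θ • p.2) ∂(μ.prod ν) := fun a => by
    rw [← integral_prod_swap]
    simp only [Prod.fst_swap, Prod.snd_swap, hsw]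
  have s2 : ∀ a b, ∫ p, H a b (Real.sin θ • p.1 + Real.cos θ • p.2) ∂(ν.prod μ)
      = ∫ p, H a b (Real.cos θ • p.1 + Real.sin θ • p.2) ∂(μ.prod ν) := fun a b => by
    rw [← integral_prod_swap]
    simp only [Prod.fst_swap, Prod.snd_swap, hsw]
  have hcov' : ∀ a b, ∫ x, (x a * x b : ℂ) ∂ν = ∫ x, (x a * x b : ℂ) ∂μ := fun a b => by
    have := congrArg (fun t : ℝ => (t : ℂ)) (hcov a b)
    simp only [← integral_complex_ofReal, Complex.ofReal_mul] at this
    exact this.symm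
  simp only [s1, s2, hcov'] at h2
  simp only [Function.comp_def, Prod.fst_swap, Prod.snd_swap, hsw] at i2
  -- The same quantity is subtracted and added, so both brackets become errors controlled by `h1`
  -- and `h2`.
  have e : ∫ p, ∑ a, ((-Real.sin θ * p.1 a + Real.cos θ * p.2 a : ℝ) : ℂ) *
        ψ a (Real.cos θ • p.1 + Real.sin θ • p.2) ∂(μ.prod ν)
      = -(Real.sin θ : ℂ) * ∑ a, (∫ p, (p.1 a : ℂ) * ψ a (Real.cos θ • p.1 + Real.sin θ • p.2)
        ∂(μ.prod ν) - (Real.cos θ : ℂ) * ∑ b, (∫ x, (x a * x b : ℂ) ∂μ) *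
          ∫ p, H a b (Real.cos θ • p.1 + Real.sin θ • p.2) ∂(μ.prod ν))
        + (Real.cos θ : ℂ) * ∑ a, (∫ p, (p.2 a : ℂ) * ψ a (Real.cos θ • p.1 + Real.sin θ • p.2)
        ∂(μ.prod ν) - (Real.sin θ : ℂ) * ∑ b, (∫ x, (x a * x b : ℂ) ∂μ) *
          ∫ p, H a b (Real.cos θ • p.1 + Real.sin θ • p.2) ∂(μ.prod ν)) := by
    have e1 : ∀ (p : (ι → ℝ) × (ι → ℝ)) a, ((-Real.sin θ * p.1 a + Real.cos θ * p.2 a : ℝ) : ℂ) *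
        ψ a (Real.cos θ • p.1 + Real.sin θ • p.2) =
        -(Real.sin θ : ℂ) * ((p.1 a : ℂ) * ψ a (Real.cos θ • p.1 + Real.sin θ • p.2)) +
        (Real.cos θ : ℂ) * ((p.2 a : ℂ) * ψ a (Real.cos θ • p.1 + Real.sin θ • p.2)) := by
      intro p a
      push_cast
      ring
    simp_rw [e1]
    have j : ∀ a ∈ Finset.univ, Integrable (fun p : (ι → ℝ) × (ι → ℝ) =>
        -(Real.sin θ : ℂ) * ((p.1 a : ℂ) * ψ a (Real.cos θ • p.1 + Real.sin θ • p.2)) +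
        (Real.cos θ : ℂ) * ((p.2 a : ℂ) * ψ a (Real.cos θ • p.1 + Real.sin θ • p.2))) (μ.prod ν) :=
      fun a _ => ((i1 a).const_mul _).add ((i2 a).const_mul _)
    rw [integral_finsetSum _ j]
    rw [Finset.mul_sum, Finset.mul_sum, ← Finset.sum_add_distrib]
    refine Finset.sum_congr rfl fun a _ => ?_
    rw [integral_add ((i1 a).const_mul _) ((i2 a).const_mul _), integral_const_mul,
      integral_const_mul]
    ring
  rw [e, Finset.sum_add_distrib, mul_add, mul_add]
  refine (norm_add_le _ _).trans (add_le_add ?_ ?_)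
  · rw [norm_mul, norm_neg, Complex.norm_real, Real.norm_eq_abs]
    exact (mul_le_of_le_one_left (norm_nonneg _) (Real.abs_sin_le_one θ)).trans h1
  · rw [norm_mul, Complex.norm_real, Real.norm_eq_abs]
    exact (mul_le_of_le_one_left (norm_nonneg _) (Real.abs_cos_le_one θ)).trans h2

/-- Lindeberg comparison for locally dependent fields. -/
theorem norm_integral_sub_integral_le (hs : 0 ≤ s) (hsymm : ∀ a b, b ∈ N a → a ∈ N b)
    (hcard : ∀ a, (N a).card ≤ m) (hμ : CenteredField N μ) (hν : CenteredField N ν)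
    (hcov : ∀ a b, ∫ x, x a * x b ∂μ = ∫ x, x a * x b ∂ν) (h : TaylorData F ψ H B c s) :
    ‖∫ x, F x ∂μ - ∫ x, F x ∂ν‖ ≤
    c * (36 * m ^ 2 *
      ∑ a, (∫ x, lindebergWeight s (x a) ∂μ + ∫ x, lindebergWeight s (x a) ∂ν)) := by
  -- Mean value inequality between θ = π/2, where the field is ν, and θ = 0, where it is μ. Bounding
  -- π/2 by 2 below turns 18 into 36.
  have hmv := convex_univ.norm_image_sub_le_of_norm_hasDerivWithin_le (x := Real.pi / 2) (y := 0)
    (fun θ _ => (hasDerivAt_integral_rotation hμ hν h θ).hasDerivWithinAt)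
    (fun θ _ => norm_integral_rotation_deriv_le hs hsymm hcard hμ hν hcov h θ)
    (Set.mem_univ _) (Set.mem_univ _)
  have hF1 : Integrable F μ := Integrable.of_bound (C := B)
    h.continuous.measurable.aestronglyMeasurable (Eventually.of_forall fun _ => h.bound _)
  have hF2 : Integrable F ν := Integrable.of_bound (C := B)
    h.continuous.measurable.aestronglyMeasurable (Eventually.of_forall fun _ => h.bound _)
  have e1 : ∫ p : (ι → ℝ) × (ι → ℝ), F p.1 ∂(μ.prod ν) = ∫ x, F x ∂μ := by
    rw [integral_prod _ (hF1.comp_fst ν)]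
    simp
  have e2 : ∫ p : (ι → ℝ) × (ι → ℝ), F p.2 ∂(μ.prod ν) = ∫ x, F x ∂ν := by
    rw [integral_prod _ (hF2.comp_snd μ)]
    simp
  simp only [Real.cos_zero, Real.sin_zero, one_smul, zero_smul, add_zero, Real.cos_pi_div_two,
    Real.sin_pi_div_two, zero_add, e1, e2] at hmv
  refine hmv.trans ?_
  rw [zero_sub, norm_neg, Real.norm_of_nonneg (by positivity)]
  have hnn : 0 ≤ c * (18 * m ^ 2 *
      ∑ a, (∫ x, lindebergWeight s (x a) ∂μ + ∫ x, lindebergWeight s (x a) ∂ν)) := by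
    refine mul_nonneg h.coeff_nonneg (mul_nonneg (by positivity) (Finset.sum_nonneg fun a _ =>
      add_nonneg (integral_nonneg fun x => lindebergWeight_nonneg hs _)
        (integral_nonneg fun x => lindebergWeight_nonneg hs _)))
  have hpi : Real.pi / 2 ≤ 2 := by linarith [Real.pi_le_four]
  refine (mul_le_mul_of_nonneg_left hpi hnn).trans (le_of_eq ?_)
  ring

end Comparison

/-! ### Exponential concentration for bounded martingale increments -/

section Azuma

variable {Ω : Type*} {mΩ : MeasurableSpace Ω} {μ : Measure Ω} [IsProbabilityMeasure μ]
  {f : Ω → ℝ} {R c : ℝ}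

theorem integrable_exp_mul_condExp (hf : ∀ x, |f x| ≤ R) (m : MeasurableSpace Ω) (hm : m ≤ mΩ)
    (t : ℝ) : Integrable (fun ω => Real.exp (t * (μ[f|m]) ω)) μ := by
  have hmeas : Measurable[mΩ] (μ[f|m]) := (stronglyMeasurable_condExp.mono hm).measurable
  refine Integrable.of_bound (C := Real.exp (|t| * R)) (by fun_prop) ?_
  filter_upwards [ae_bdd_abs_condExp_of_ae_bdd_abs (m := m) (Eventually.of_forall hf)] with ω hω
  rw [Real.norm_of_nonneg (Real.exp_pos _).le, Real.exp_le_exp]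
  refine (le_abs_self _).trans ?_
  rw [abs_mul]
  gcongr

/-- By convexity, exp(tΔ) ≤ cosh(ct) + (Δ/c) sinh(ct) for an increment |Δ| ≤ c. The term linear in Δ
is orthogonal to the `m₁`-measurable factor Y and integrates to zero. -/
theorem integral_exp_condExp_le (hfm : Measurable f) (hf : ∀ x, |f x| ≤ R)
    {m₁ m₂ : MeasurableSpace Ω} (h12 : m₁ ≤ m₂) (h2 : m₂ ≤ mΩ) (hc : 0 < c)
    (hd : ∀ᵐ ω ∂μ, |(μ[f|m₂]) ω - (μ[f|m₁]) ω| ≤ c) (t : ℝ) :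
    ∫ ω, Real.exp (t * (μ[f|m₂]) ω) ∂μ
      ≤ Real.cosh (c * t) * ∫ ω, Real.exp (t * (μ[f|m₁]) ω) ∂μ := by
  have h1 := h12.trans h2
  set Y : Ω → ℝ := fun ω => Real.exp (t * (μ[f|m₁]) ω) with hYdef
  have hY : StronglyMeasurable[m₁] Y :=
    Real.continuous_exp.comp_stronglyMeasurable (stronglyMeasurable_condExp.const_mul t)
  have hYi : Integrable Y μ := integrable_exp_mul_condExp hf m₁ h1 t
  have hfi : Integrable f μ := Integrable.of_bound (C := R) hfm.aestronglyMeasurable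
    (Eventually.of_forall hf)
  have hYM : ∀ m ≤ mΩ, Integrable (Y * μ[f|m]) μ := fun m hm =>
    hYi.mul_bdd (c := R) (stronglyMeasurable_condExp.mono hm).aestronglyMeasurable
      (ae_bdd_abs_condExp_of_ae_bdd_abs (Eventually.of_forall hf))
  have horth : ∫ ω, Y ω * (μ[f|m₂]) ω ∂μ = ∫ ω, Y ω * (μ[f|m₁]) ω ∂μ := by
    have e1 := condExp_mul_of_stronglyMeasurable_left hY (hYM m₂ h2) integrable_condExp
    have e2 := condExp_condExp_of_le (μ := μ) (f := f) h12 h2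
    have e3 := integral_condExp (μ := μ) (f := Y * μ[f|m₂]) h1
    calc _ = ∫ ω, (μ[Y * μ[f|m₂]|m₁]) ω ∂μ := e3.symm
      _ = _ := by
        refine integral_congr_ae ?_
        filter_upwards [e1, e2] with ω h h'
        rw [h, Pi.mul_apply, h']
  have hpt : ∀ᵐ ω ∂μ, Real.exp (t * (μ[f|m₂]) ω) ≤ Real.cosh (c * t) * Y ω +
      (Real.sinh (c * t) / c) * (Y ω * (μ[f|m₂]) ω - Y ω * (μ[f|m₁]) ω) := by
    filter_upwards [hd] with ω hω
    have hu : |((μ[f|m₂]) ω - (μ[f|m₁]) ω) / c| ≤ 1 := by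
      rw [abs_div, abs_of_pos hc]
      exact (div_le_one hc).2 hω
    have h3 := Real.exp_mul_le_cosh_add_mul_sinh hu (c * t)
    have h4 : Real.exp (t * (μ[f|m₂]) ω)
        = Y ω * Real.exp (((μ[f|m₂]) ω - (μ[f|m₁]) ω) / c * (c * t)) := by
      rw [hYdef, ← Real.exp_add]
      congr 1
      field_simp
      ring
    rw [h4]
    refine (mul_le_mul_of_nonneg_left h3 (Real.exp_pos _).le).trans (le_of_eq ?_)
    ring
  have i1 : Integrable (fun ω => Y ω * (μ[f|m₂]) ω) μ := hYM m₂ h2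
  have i2 : Integrable (fun ω => Y ω * (μ[f|m₁]) ω) μ := hYM m₁ h1
  have i3 : Integrable (fun ω => (Real.sinh (c * t) / c) *
      (Y ω * (μ[f|m₂]) ω - Y ω * (μ[f|m₁]) ω)) μ := (i1.sub i2).const_mul _
  refine (integral_mono_ae (integrable_exp_mul_condExp hf m₂ h2 t)
    ((hYi.const_mul _).add i3) hpt).trans (le_of_eq ?_)
  rw [integral_add' (hYi.const_mul _) i3, integral_const_mul, integral_const_mul,
    integral_sub i1 i2, horth, sub_self, mul_zero, add_zero]

/-- Azuma's argument: iterate the one-step bound with cosh u ≤ exp(u²/2), then apply Chernoff's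
inequality. -/
theorem measure_ge_le_of_condExp_increments (hfm : Measurable f) (hf : ∀ x, |f x| ≤ R)
    (ℱ : ℕ → MeasurableSpace Ω) (hmono : ∀ i, ℱ i ≤ ℱ (i + 1)) (hle : ∀ i, ℱ i ≤ mΩ)
    (hbot : ℱ 0 = ⊥) {n : ℕ} (hn : 0 < n) (htop : ℱ n = mΩ) (hc : 0 < c)
    (hd : ∀ i < n, ∀ᵐ ω ∂μ, |(μ[f|ℱ (i + 1)]) ω - (μ[f|ℱ i]) ω| ≤ c) {ε : ℝ} (hε : 0 ≤ ε) :
    μ.real {ω | ε ≤ f ω - ∫ x, f x ∂μ} ≤ Real.exp (-(ε ^ 2 / (2 * n * c ^ 2))) := by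
  have hfi : Integrable f μ := Integrable.of_bound (C := R) hfm.aestronglyMeasurable
    (Eventually.of_forall hf)
  set e := ∫ x, f x ∂μ with he
  have key : ∀ t : ℝ, ∀ i ≤ n, ∫ ω, Real.exp (t * (μ[f|ℱ i]) ω) ∂μ
      ≤ Real.exp (i * ((c * t) ^ 2 / 2)) * Real.exp (t * e) := by
    intro t i
    induction i with
    | zero => intro _; simp [hbot, condExp_bot, he]
    | succ i ih =>
      intro hi
      refine (integral_exp_condExp_le hfm hf (hmono i) (hle _) hc (hd i hi) t).trans ?_
      refine (mul_le_mul (Real.cosh_le_exp_half_sq _) (ih (Nat.le_of_succ_le hi))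
        (integral_nonneg fun ω => (Real.exp_pos _).le) (Real.exp_pos _).le).trans (le_of_eq ?_)
      rw [← mul_assoc, ← Real.exp_add]
      congr 2
      push_cast
      ring
  have hfin : μ[f|ℱ n] = f := condExp_of_stronglyMeasurable (hle n)
    (by rw [htop]; exact hfm.stronglyMeasurable) hfi
  have hn' : (0 : ℝ) < n := Nat.cast_pos.2 hn
  -- The minimizer of -tε + n c² t²/2.
  set t := ε / (n * c ^ 2) with ht
  have ht0 : 0 ≤ t := by positivity
  have hk := key t n le_rfl
  rw [hfin] at hk
  have hi0 : Integrable (fun ω => Real.exp (t * f ω)) μ := by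
    have := integrable_exp_mul_condExp (μ := μ) hf (ℱ n) (hle n) t
    rwa [hfin] at this
  have hsplit : ∀ ω, Real.exp (t * (f ω - e)) = Real.exp (t * f ω) * Real.exp (-(t * e)) := by
    intro ω
    rw [← Real.exp_add]
    congr 1
    ring
  refine (measure_ge_le_exp_mul_mgf ε ht0 (by simp_rw [hsplit]; exact hi0.mul_const _)).trans ?_
  unfold mgf
  simp_rw [hsplit]
  rw [integral_mul_const]
  calc _ ≤ Real.exp (-t * ε) * (Real.exp (n * ((c * t) ^ 2 / 2)) * Real.exp (t * e)
        * Real.exp (-(t * e))) := by gcongr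
    _ = Real.exp (-(ε ^ 2 / (2 * n * c ^ 2))) := by
        rw [← Real.exp_add, ← Real.exp_add, ← Real.exp_add]
        congr 1
        rw [ht]
        field_simp
        ring

end Azuma

/-! ### Bounded differences for locally dependent fields -/

section Freezing

variable {Ω E E' : Type*} {mΩ : MeasurableSpace Ω} {μ : Measure Ω} [IsProbabilityMeasure μ]
  [MeasurableSpace E] [MeasurableSpace E'] {U : Ω → E} {V : Ω → E'}

/-- Freezing: conditioning on U keeps U fixed and integrates the independent V out. It is checked on
the sets U⁻¹(A) with Fubini for the product law. -/
theorem condExp_comap_of_indepFun (hU : Measurable U) (hV : Measurable V) (hUV : IndepFun U V μ)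
    {Φ : E × E' → ℝ} (hΦ : Measurable Φ) {R : ℝ} (hR : ∀ p, |Φ p| ≤ R) :
    μ[fun ω => Φ (U ω, V ω)|MeasurableSpace.comap U inferInstance]
      =ᵐ[μ] fun ω => ∫ v, Φ (U ω, v) ∂(μ.map V) := by
  have : IsProbabilityMeasure (μ.map V) := Measure.isProbabilityMeasure_map hV.aemeasurable
  have : IsProbabilityMeasure (μ.map U) := Measure.isProbabilityMeasure_map hU.aemeasurable
  have hbound : ∀ u, ‖∫ v, Φ (u, v) ∂(μ.map V)‖ ≤ R := fun u => by
    refine (norm_integral_le_of_norm_le_const (Eventually.of_forall fun v => hR (u, v))).trans ?_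
    simp
  have hΨ : StronglyMeasurable fun u => ∫ v, Φ (u, v) ∂(μ.map V) :=
    hΦ.stronglyMeasurable.integral_prod_right'
  refine (ae_eq_condExp_of_forall_setIntegral_eq hU.comap_le
    (Integrable.of_bound (C := R) (hΦ.comp (hU.prodMk hV)).aestronglyMeasurable
      (Eventually.of_forall fun ω => hR _)) (fun s _ _ => ?_) ?_ ?_).symm
  · exact (Integrable.of_bound (C := R) (hΨ.comp_measurable hU).aestronglyMeasurable
      (Eventually.of_forall fun ω => hbound _)).integrableOn
  · rintro s ⟨A, hA, rfl⟩ _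
    have hprod := (indepFun_iff_map_prod_eq_prod_map_map hU.aemeasurable hV.aemeasurable).1 hUV
    have h1 : ∫ ω in U ⁻¹' A, Φ (U ω, V ω) ∂μ
        = ∫ p in A ×ˢ Set.univ, Φ p ∂((μ.map U).prod (μ.map V)) := by
      rw [← hprod, setIntegral_map (hA.prod MeasurableSet.univ) hΦ.aestronglyMeasurable
        (hU.prodMk hV).aemeasurable]
      congr 2
      ext ω
      simp
    have hi : IntegrableOn Φ (A ×ˢ Set.univ) ((μ.map U).prod (μ.map V)) :=
      (Integrable.of_bound (C := R) hΦ.aestronglyMeasurable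
        (Eventually.of_forall hR)).integrableOn
    change _ = ∫ ω in U ⁻¹' A, Φ (U ω, V ω) ∂μ
    rw [h1, setIntegral_prod _ hi]
    simp only [Measure.restrict_univ]
    rw [setIntegral_map hA hΨ.aestronglyMeasurable hU.aemeasurable]
  · exact (hΨ.comp_measurable (comap_measurable U)).aestronglyMeasurable

end Freezing

/-! ### Martingale increments under local dependence -/

section BoundedDifferences

variable {ι : Type*} {μ : Measure (ι → ℝ)} [IsProbabilityMeasure μ] {f : (ι → ℝ) → ℝ} {R δ : ℝ}

theorem comap_indicator_le (S : Set ι) :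
    MeasurableSpace.comap (fun x : ι → ℝ => S.indicator x) inferInstance
      ≤ (inferInstance : MeasurableSpace (ι → ℝ)) := (measurable_indicator_pi S).comap_le

theorem comap_indicator_mono {S S' : Set ι} (h : S ⊆ S') :
    MeasurableSpace.comap (fun x : ι → ℝ => S.indicator x) inferInstance
      ≤ MeasurableSpace.comap (fun x : ι → ℝ => S'.indicator x) inferInstance := by
  have e : (fun x : ι → ℝ => S.indicator x)
      = (fun x : ι → ℝ => S.indicator x) ∘ fun x : ι → ℝ => S'.indicator x := by
    funext x
    simp [Set.indicator_indicator, Set.inter_eq_left.2 h]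
  conv_lhs => rw [e, ← MeasurableSpace.comap_comp]
  exact MeasurableSpace.comap_mono (comap_indicator_le S)

/-- Replace f by g, which sees only S and T. As T is independent of S' ⊇ S, conditioning g on S' or
on S gives the same result, so only the conditional expectations of f - g contribute, each at most
δ. -/
theorem abs_condExp_sub_le (hfm : Measurable f) (hf : ∀ x, |f x| ≤ R) {S S' T : Set ι}
    (h : S ⊆ S')
    (hind : IndepFun (fun x : ι → ℝ => S'.indicator x) (fun x : ι → ℝ => T.indicator x) μ)
    (hδ : ∀ x, |f x - f (S.indicator x + T.indicator x)| ≤ δ) :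
    ∀ᵐ x ∂μ, |(μ[f|MeasurableSpace.comap (fun x : ι → ℝ => S'.indicator x) inferInstance]) x -
      (μ[f|MeasurableSpace.comap (fun x : ι → ℝ => S.indicator x) inferInstance]) x| ≤ 2 * δ := by
  set g : (ι → ℝ) → ℝ := fun x => f (S.indicator x + T.indicator x) with hg
  have hgm : Measurable g := hfm.comp ((measurable_indicator_pi S).add (measurable_indicator_pi T))
  have hfi : Integrable f μ := Integrable.of_bound (C := R) hfm.aestronglyMeasurable
    (Eventually.of_forall hf)
  have hgi : Integrable g μ := Integrable.of_bound (C := R) hgm.aestronglyMeasurable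
    (Eventually.of_forall fun x => hf _)
  have hSS : ∀ x : ι → ℝ, S.indicator (S'.indicator x) = S.indicator x := fun x => by
    rw [Set.indicator_indicator, Set.inter_eq_left.2 h]
  have hind2 : IndepFun (fun x : ι → ℝ => S.indicator x) (fun x : ι → ℝ => T.indicator x) μ := by
    have := hind.comp (measurable_indicator_pi S) measurable_id
    simpa [Function.comp_def, hSS] using this
  -- Restricting the first argument to S inside Φ makes the frozen integral given S' the same
  -- function of x as the one given S in `e2`.
  have e1 := condExp_comap_of_indepFun (measurable_indicator_pi S') (measurable_indicator_pi T)
    hind (Φ := fun p => f (S.indicator p.1 + p.2))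
    (hfm.comp (((measurable_indicator_pi S).comp measurable_fst).add measurable_snd))
    fun p => hf _
  have e2 := condExp_comap_of_indepFun (measurable_indicator_pi S) (measurable_indicator_pi T)
    hind2 (Φ := fun p => f (p.1 + p.2)) (hfm.comp (measurable_fst.add measurable_snd))
    fun p => hf _
  simp only [hSS] at e1
  have b : ∀ m : MeasurableSpace (ι → ℝ), ∀ᵐ x ∂μ, |(μ[f - g|m]) x| ≤ δ := fun m =>
    ae_bdd_abs_condExp_of_ae_bdd_abs (Eventually.of_forall hδ)
  filter_upwards [e1, e2, b (MeasurableSpace.comap (fun x : ι → ℝ => S'.indicator x) inferInstance),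
    b (MeasurableSpace.comap (fun x : ι → ℝ => S.indicator x) inferInstance),
    condExp_sub hfi hgi (MeasurableSpace.comap (fun x : ι → ℝ => S'.indicator x) inferInstance),
    condExp_sub hfi hgi (MeasurableSpace.comap (fun x : ι → ℝ => S.indicator x) inferInstance)]
    with x h1 h2 h3 h4 h5 h6
  rw [h5, Pi.sub_apply, abs_le] at h3
  rw [h6, Pi.sub_apply, abs_le] at h4
  rw [abs_le]
  constructor <;> linarith [h3.1, h3.2, h4.1, h4.2]

end BoundedDifferences

/-! ### Concentration of the Stieltjes transform -/

section Concentration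

variable {n : ℕ}

def gridNbhd (K : ℕ) (a : LowerIdx n) : Finset (LowerIdx n) :=
  Finset.univ.filter fun b => gridDist a b ≤ K

theorem mem_gridNbhd {K : ℕ} {a b : LowerIdx n} : b ∈ gridNbhd K a ↔ gridDist a b ≤ K := by
  simp [gridNbhd]

/-- Azuma for the filtration by rows. Increments are at most 2δ = 8(K+1)/(n Im z), and 2n(2δ)² =
128(K+1)²/(n (Im z)²). -/
theorem measure_lowerStieltjes_component_ge_le {z : ℂ} (hz : 0 < z.im) {K : ℕ} (hn : 0 < n)
    {μ : Measure (LowerIdx n → ℝ)} [IsProbabilityMeasure μ]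
    (hμ : LocallyDependent (gridNbhd K) μ) (p : ℂ →L[ℝ] ℝ) (hp : ∀ w, |p w| ≤ ‖w‖)
    {ε : ℝ} (hε : 0 ≤ ε) :
    μ.real {x | ε ≤ p (lowerStieltjes z x) - ∫ x, p (lowerStieltjes z x) ∂μ}
      ≤ Real.exp (-(ε ^ 2 * z.im ^ 2 / (128 * (K + 1) ^ 2)) * n) := by
  obtain ⟨B, hB⟩ := lower_taylorData hn hz
  have hn' : (0 : ℝ) < n := Nat.cast_pos.2 hn
  set f : (LowerIdx n → ℝ) → ℝ := fun x => p (lowerStieltjes z x) with hf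
  have hne : Nonempty (LowerIdx n) := ⟨⟨(⟨0, hn⟩, ⟨0, hn⟩), le_rfl⟩⟩
  have hfm : Measurable f := p.continuous.measurable.comp hB.continuous.measurable
  have hfB : ∀ x, |f x| ≤ B := fun x => (hp _).trans (hB.bound x)
  set S : ℕ → Set (LowerIdx n) := fun i => {a | (a.1.1 : ℕ) < i}
  set δ : ℝ := 4 * (K + 1) * z.im⁻¹ / n with hδ
  have hδ0 : 0 < δ := by positivity
  have hS : ∀ i, S i ⊆ S (i + 1) := fun i a ha => Nat.lt_succ_of_lt ha
  have hmain := measure_ge_le_of_condExp_increments (μ := μ) hfm hfB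
    (fun i => MeasurableSpace.comap (fun x : LowerIdx n → ℝ => (S i).indicator x) inferInstance)
    (fun i => comap_indicator_mono (hS i)) (fun i => comap_indicator_le _) ?_ hn ?_
    (c := 2 * δ) (by positivity) (fun i _ => ?_) hε
  · refine hmain.trans (le_of_eq ?_)
    rw [hδ]
    congr 1
    field_simp
    ring
  · have : (fun x : LowerIdx n → ℝ => (S 0).indicator x) = fun _ => 0 := by
      funext x
      simp [S]
      rfl
    rw [this, MeasurableSpace.comap_const]
  · have : (fun x : LowerIdx n → ℝ => (S n).indicator x) = id := by
      funext x
      have : S n = Set.univ := by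
        ext a
        simp [S]
      simp [this]
    rw [this, MeasurableSpace.comap_id]
  -- Known rows after the step are at most i, rows in T at least i + K + 1, so their distance
  -- exceeds K; exactly K + 1 row indices lie outside S i and T.
  · set T : Set (LowerIdx n) := {a | i + K < (a.1.1 : ℕ)}
    refine abs_condExp_sub_le hfm hfB (hS i) (T := T) (hμ _ _ fun a ha b hb => ?_) fun x => ?_
    · rw [mem_gridNbhd, not_le]
      refine lt_of_lt_of_le ?_ (le_max_left _ _)
      have ha' : (a.1.1 : ℕ) < i + 1 := ha
      have hb' : i + K < (b.1.1 : ℕ) := hb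
      rw [lt_abs]
      right
      omega
    · rw [hf, ← map_sub]
      refine (hp _).trans ?_
      set Q : Finset (Fin n) := Finset.univ.filter fun j => i ≤ (j : ℕ) ∧ (j : ℕ) ≤ i + K
      have hQ : Q.card ≤ K + 1 := by
        have : Q.card ≤ (Finset.Icc i (i + K)).card :=
          Finset.card_le_card_of_injOn (fun j => (j : ℕ)) (fun j hj => by
            simpa [Q] using hj) (fun a _ b _ h => Fin.ext h)
        simpa using this.trans (by simp; omega)
      have h1 := norm_lowerStieltjes_sub_le hn hz Q ((S i).indicator x + T.indicator x) x
        (fun a ha => by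
          have ha' : ¬ (i ≤ (a.1.1 : ℕ) ∧ (a.1.1 : ℕ) ≤ i + K) := by simpa [Q] using ha
          rcases lt_or_ge (a.1.1 : ℕ) i with h | h
          · have hT : a ∉ T := fun h' => by
              have : i + K < (a.1.1 : ℕ) := h'
              omega
            have hSa : a ∈ S i := h
            simp [hT, hSa]
          · have hT : a ∈ T := by
              change i + K < (a.1.1 : ℕ)
              omega
            have hSa : a ∉ S i := not_lt.2 h
            simp [hT, hSa])
      refine h1.trans ?_
      rw [hδ]
      have : (Q.card : ℝ) ≤ K + 1 := by exact_mod_cast hQ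
      gcongr

/-- A complex number of modulus at least ε has real or imaginary part of modulus at least ε/2; this
gives four one-sided events. -/
theorem measure_lowerStieltjes_ge_le {z : ℂ} (hz : 0 < z.im) {K : ℕ} (hn : 0 < n)
    {μ : Measure (LowerIdx n → ℝ)} [IsProbabilityMeasure μ]
    (hμ : LocallyDependent (gridNbhd K) μ) {ε : ℝ} (hε : 0 ≤ ε) :
    μ.real {x | ε ≤ ‖lowerStieltjes z x - ∫ x, lowerStieltjes z x ∂μ‖}
      ≤ 4 * Real.exp (-((ε / 2) ^ 2 * z.im ^ 2 / (128 * (K + 1) ^ 2)) * n) := by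
  obtain ⟨B, hB⟩ := lower_taylorData hn hz
  have hne : Nonempty (LowerIdx n) := ⟨⟨(⟨0, hn⟩, ⟨0, hn⟩), le_rfl⟩⟩
  have hint : Integrable (lowerStieltjes z) μ := Integrable.of_bound (C := B)
    hB.continuous.measurable.aestronglyMeasurable (Eventually.of_forall fun _ => hB.bound _)
  have hre : ∀ w : ℂ, |Complex.reCLM w| ≤ ‖w‖ := Complex.abs_re_le_norm
  have him : ∀ w : ℂ, |Complex.imCLM w| ≤ ‖w‖ := Complex.abs_im_le_norm
  have hneg : ∀ p : ℂ →L[ℝ] ℝ, (∀ w, |p w| ≤ ‖w‖) → ∀ w, |(-p) w| ≤ ‖w‖ := fun p hp w => by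
    simpa using hp w
  have hc := fun p hp => measure_lowerStieltjes_component_ge_le hz hn hμ p hp
    (div_nonneg hε zero_le_two)
  set A : (ℂ →L[ℝ] ℝ) → Set (LowerIdx n → ℝ) := fun p =>
    {x | ε / 2 ≤ p (lowerStieltjes z x) - ∫ x, p (lowerStieltjes z x) ∂μ}
  have hsub : {x | ε ≤ ‖lowerStieltjes z x - ∫ x, lowerStieltjes z x ∂μ‖} ⊆
      (A Complex.reCLM ∪ A (-Complex.reCLM)) ∪ (A Complex.imCLM ∪ A (-Complex.imCLM)) := by
    intro x hx
    have hA : ∀ p : ℂ →L[ℝ] ℝ, x ∈ A p ↔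
        ε / 2 ≤ p (lowerStieltjes z x - ∫ x, lowerStieltjes z x ∂μ) := fun p => by
      change ε / 2 ≤ p (lowerStieltjes z x) - ∫ x, p (lowerStieltjes z x) ∂μ ↔ _
      rw [p.integral_comp_comm hint, map_sub]
    simp only [Set.mem_union, hA, _root_.neg_apply, Complex.reCLM_apply,
      Complex.imCLM_apply, ← le_abs]
    have hx' : ε ≤ ‖lowerStieltjes z x - ∫ x, lowerStieltjes z x ∂μ‖ := hx
    have h2 := Complex.norm_le_abs_re_add_abs_im
      (lowerStieltjes z x - ∫ x, lowerStieltjes z x ∂μ)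
    by_contra! hcon
    linarith [hcon.1, hcon.2]
  refine (measureReal_mono hsub).trans ?_
  refine (measureReal_union_le _ _).trans ?_
  have u1 := measureReal_union_le (μ := μ) (A Complex.reCLM) (A (-Complex.reCLM))
  have u2 := measureReal_union_le (μ := μ) (A Complex.imCLM) (A (-Complex.imCLM))
  linarith [hc _ hre, hc _ him, hc _ (hneg _ hre), hc _ (hneg _ him)]

end Concentration

/-! ### The grid neighbourhoods -/

section Grid

variable {n : ℕ}

theorem gridNbhd_symm (K : ℕ) (a b : LowerIdx n) (h : b ∈ gridNbhd K a) : a ∈ gridNbhd K b := by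
  rw [mem_gridNbhd] at h ⊢
  rwa [gridDist, abs_sub_comm, abs_sub_comm ((b.1.2 : ℕ) : ℤ)]

theorem card_gridNbhd_le (K : ℕ) (a : LowerIdx n) : (gridNbhd K a).card ≤ (2 * K + 1) ^ 2 := by
  have h : (gridNbhd K a).card ≤ (Finset.Icc (((a.1.1 : ℕ) : ℤ) - K) (((a.1.1 : ℕ) : ℤ) + K) ×ˢ
      Finset.Icc (((a.1.2 : ℕ) : ℤ) - K) (((a.1.2 : ℕ) : ℤ) + K)).card := by
    refine Finset.card_le_card_of_injOn
      (fun b => (((b.1.1 : ℕ) : ℤ), ((b.1.2 : ℕ) : ℤ))) (fun b hb => ?_) (fun b _ b' _ h => ?_)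
    · have hb' := mem_gridNbhd.1 hb
      rw [gridDist, max_le_iff, abs_le, abs_le] at hb'
      simp only [Finset.coe_product, Finset.coe_Icc, Set.mem_prod, Set.mem_Icc]
      omega
    · simp only [Prod.mk.injEq, Nat.cast_inj] at h
      exact Subtype.ext (Prod.ext (Fin.ext h.1) (Fin.ext h.2))
  refine h.trans (le_of_eq ?_)
  rw [Finset.card_product, Int.card_Icc, Int.card_Icc, sq]
  congr 1 <;> omega

end Grid

/-! ### The law of the entries -/

section Law

variable {ι Ω : Type*} [MeasurableSpace Ω] {P : Measure Ω} [IsProbabilityMeasure P]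

theorem indepFun_map_of_indepFun {E E₁ E₂ : Type*} [MeasurableSpace E] [MeasurableSpace E₁]
    [MeasurableSpace E₂] {Y : Ω → E} {f : E → E₁} {g : E → E₂} (hY : Measurable Y)
    (hf : Measurable f) (hg : Measurable g) (h : IndepFun (f ∘ Y) (g ∘ Y) P) :
    IndepFun f g (P.map Y) := by
  have : IsProbabilityMeasure (P.map Y) := Measure.isProbabilityMeasure_map hY.aemeasurable
  rw [indepFun_iff_map_prod_eq_prod_map_map hf.aemeasurable hg.aemeasurable,
    Measure.map_map (hf.prodMk hg) hY, Measure.map_map hf hY, Measure.map_map hg hY]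
  exact (indepFun_iff_map_prod_eq_prod_map_map (hf.comp hY).aemeasurable
    (hg.comp hY).aemeasurable).1 h

theorem locallyDependent_map {n K : ℕ} {M : Ω → Matrix (Fin n) (Fin n) ℝ}
    (hM : ∀ k l, Measurable fun ω => M ω k l)
    (h : ∀ A B : Set (LowerIdx n), A.Nonempty → B.Nonempty →
      (∀ p ∈ A, ∀ q ∈ B, (K : ℤ) < gridDist p q) →
      Indep (entriesSigma M A) (entriesSigma M B) P) :
    LocallyDependent (gridNbhd K) (P.map fun ω (p : LowerIdx n) => M ω p.1.1 p.1.2) := by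
  intro S T hST
  have hY : Measurable fun ω (p : LowerIdx n) => M ω p.1.1 p.1.2 :=
    measurable_pi_iff.2 fun p => hM _ _
  refine indepFun_map_of_indepFun hY (measurable_indicator_pi S) (measurable_indicator_pi T) ?_
  -- Independence is assumed for nonempty sets of positions only; an empty set gives a constant
  -- function.
  rcases S.eq_empty_or_nonempty with rfl | hS
  · simp only [Set.indicator_empty, Function.comp_def]
    exact indepFun_const_left _ _
  rcases T.eq_empty_or_nonempty with rfl | hT
  · simp only [Set.indicator_empty, Function.comp_def]
    exact indepFun_const_right _ _
  have hi := h S T hS hT fun p hp q hq => by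
    have := hST p hp q hq
    rwa [mem_gridNbhd, not_le] at this
  have hle : ∀ A : Set (LowerIdx n), MeasurableSpace.comap
      ((fun x : LowerIdx n → ℝ => A.indicator x) ∘ fun ω (p : LowerIdx n) => M ω p.1.1 p.1.2)
      inferInstance ≤ entriesSigma M A := by
    intro A
    rw [← measurable_iff_comap_le]
    refine @measurable_pi_iff _ _ _ (entriesSigma M A) _ _ |>.2 fun p => ?_
    by_cases hp : p ∈ A
    · simp only [Function.comp_def, Set.indicator_of_mem hp]
      rw [measurable_iff_comap_le]
      exact le_iSup₂_of_le p hp le_rfl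
    · simp only [Function.comp_def, Set.indicator_of_notMem hp]
      exact measurable_const
  exact indep_of_indep_of_le_left (indep_of_indep_of_le_right hi (hle T)) (hle S)

end Law

/-! ### Gaussian fields -/

section Gaussian

variable {ι : Type*} [Fintype ι] {N : ι → Finset ι} {μ ν : Measure (ι → ℝ)}
  [IsProbabilityMeasure μ] [IsProbabilityMeasure ν]

/-- The two restrictions are jointly Gaussian, as a linear image of the field, so vanishing
cross-covariances imply independence. -/
theorem locallyDependent_of_gaussian (hν : HasGaussianLaw (id : (ι → ℝ) → ι → ℝ) ν)
    (hmean : ∀ a, ∫ x, x a ∂ν = 0) (hcov : ∀ a b, b ∉ N a → ∫ x, x a * x b ∂ν = 0) :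
    LocallyDependent N ν := by
  classical
  intro S T hST
  have hm : ∀ a, MemLp (fun x : ι → ℝ => x a) 2 ν := fun a =>
    (hν.map (ContinuousLinearMap.proj (R := ℝ) (φ := fun _ : ι => ℝ) a)).memLp_two
  let LS : Set ι → (ι → ℝ) →L[ℝ] (ι → ℝ) := fun S => ContinuousLinearMap.pi fun a =>
    if a ∈ S then ContinuousLinearMap.proj (R := ℝ) (φ := fun _ : ι => ℝ) a else 0
  have hLS : ∀ (S : Set ι) (x : ι → ℝ) a, LS S x a = S.indicator x a := by
    intro S x a
    by_cases ha : a ∈ S <;> simp [LS, ha]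
  have hG : HasGaussianLaw (fun x : ι → ℝ => (fun a => S.indicator x a, fun a => T.indicator x a))
      ν := by
    have h1 := hν.map ((LS S).prod (LS T))
    have h2 : (((LS S).prod (LS T)) ∘ (id : (ι → ℝ) → ι → ℝ))
        = fun x : ι → ℝ => (fun a => S.indicator x a, fun a => T.indicator x a) := by
      funext x
      exact Prod.ext (funext fun a => hLS S x a) (funext fun a => hLS T x a)
    rwa [h2] at h1
  refine hG.indepFun_of_covariance_eval fun a b => ?_
  by_cases ha : a ∈ S
  · by_cases hb : b ∈ T
    · simp only [Set.indicator_of_mem ha, Set.indicator_of_mem hb]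
      rw [covariance_eq_sub (hm a) (hm b), hmean a, zero_mul, sub_zero]
      exact hcov a b (hST a ha b hb)
    · simp only [Set.indicator_of_notMem hb]
      exact covariance_const_right _
  · simp only [Set.indicator_of_notMem ha]
    exact covariance_const_left _

omit [IsProbabilityMeasure μ] in
-- Covariances of μ vanish off the neighbourhoods and pass to ν, so the Gaussian field obeys the
-- same local dependence.
theorem centeredField_of_gaussian (hμ : CenteredField N μ)
    (hν : HasGaussianLaw (id : (ι → ℝ) → ι → ℝ) ν) (hmean : ∀ a, ∫ x, x a ∂ν = 0)
    (hcov : ∀ a b, ∫ x, x a * x b ∂μ = ∫ x, x a * x b ∂ν) : CenteredField N ν where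
  memLp a := (hν.map (ContinuousLinearMap.proj (R := ℝ) (φ := fun _ : ι => ℝ) a)).memLp_two
  mean := hmean
  dep := locallyDependent_of_gaussian hν hmean fun a b hb => by
    have h1 := hμ.integral_mul_eq_zero hb
    simp only [← Complex.ofReal_mul, integral_complex_ofReal] at h1
    rw [← hcov]
    exact_mod_cast h1

theorem pow_four_le_exp (x : ℝ) : x ^ 4 ≤ 24 * (Real.exp x + Real.exp (-x)) := by
  have h1 := Real.pow_div_factorial_le_exp |x| (abs_nonneg x) 4
  have h2 : |x| ^ 4 = x ^ 4 := Even.pow_abs (by decide) x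
  have h3 : Real.exp |x| ≤ Real.exp x + Real.exp (-x) := by
    rcases abs_cases x with ⟨h, _⟩ | ⟨h, _⟩ <;> rw [h] <;> linarith [Real.exp_pos x, Real.exp_pos (-x)]
  rw [h2, div_le_iff₀ (by positivity)] at h1
  have h4 : ((Nat.factorial 4 : ℕ) : ℝ) = 24 := by norm_num [Nat.factorial]
  rw [h4] at h1
  linarith

/-- Rescale to unit variance, where both exponential moments equal e^{1/2} ≤ 2; then 96 = 24·(2 +
2). The sharp constant is not needed. Zero variance is treated apart. -/
theorem integral_pow_four_le_of_gaussian {Ω : Type*} [MeasurableSpace Ω] {Q : Measure Ω}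
    [IsProbabilityMeasure Q] {Y : Ω → ℝ} (hY : HasGaussianLaw Y Q) (h0 : ∫ ω, Y ω ∂Q = 0) :
    Integrable (fun ω => Y ω ^ 4) Q ∧
      ∫ ω, Y ω ^ 4 ∂Q ≤ 96 * (∫ ω, Y ω ^ 2 ∂Q) ^ 2 := by
  have hi : Integrable (fun ω => Y ω ^ 4) Q := by
    have h := (hY.memLp (p := 4) (by norm_num)).integrable_norm_pow (by norm_num)
    simpa [Even.pow_abs (show Even 4 by decide)] using h
  refine ⟨hi, ?_⟩
  have hvar : Var[Y; Q] = ∫ ω, Y ω ^ 2 ∂Q := variance_of_integral_eq_zero hY.aemeasurable h0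
  set v := ∫ ω, Y ω ^ 2 ∂Q with hv
  have hv0 : 0 ≤ v := integral_nonneg fun ω => sq_nonneg _
  rcases hv0.eq_or_lt with h | h
  · have h1 : (fun ω => Y ω ^ 2) =ᵐ[Q] 0 :=
      (integral_eq_zero_iff_of_nonneg (fun ω => sq_nonneg _) hY.memLp_two.integrable_sq).1 h.symm
    have h2 : ∫ ω, Y ω ^ 4 ∂Q = 0 := by
      refine integral_eq_zero_of_ae ?_
      filter_upwards [h1] with ω hω
      have : Y ω = 0 := by simpa using hω
      simp [this]
    rw [h2]
    positivity
  · have hmap := hY.map_eq_gaussianReal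
    rw [hvar, h0] at hmap
    set t := (√v)⁻¹ with ht
    have ht2 : t ^ 2 = v⁻¹ := by rw [ht, inv_pow, Real.sq_sqrt hv0]
    have hmgf : ∀ u : ℝ, u ^ 2 = v⁻¹ → ∫ ω, Real.exp (u * Y ω) ∂Q = Real.exp (1 / 2) := by
      intro u hu
      have := mgf_gaussianReal hmap u
      rw [mgf] at this
      rw [this, hu, Real.coe_toNNReal _ hv0]
      congr 1
      field_simp
      ring
    have hint : ∀ u : ℝ, Integrable (fun ω => Real.exp (u * Y ω)) Q := by
      intro u
      have := integrable_exp_mul_gaussianReal (μ := 0) (v := v.toNNReal) u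
      rw [← hmap] at this
      exact this.comp_aemeasurable hY.aemeasurable
    have hpt : ∀ ω, t ^ 4 * Y ω ^ 4 ≤ 24 * (Real.exp (t * Y ω) + Real.exp (-t * Y ω)) := by
      intro ω
      have := pow_four_le_exp (t * Y ω)
      rwa [mul_pow, ← neg_mul] at this
    have h5 := integral_mono (hi.const_mul _) (((hint t).add (hint (-t))).const_mul 24) hpt
    rw [integral_const_mul, integral_const_mul, integral_add' (hint t) (hint (-t)), hmgf t ht2,
      hmgf (-t) (by rw [neg_sq, ht2])] at h5
    have h6 : Real.exp (1 / 2) ≤ 2 := by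
      have h7 : Real.exp (1 / 2) ^ 2 = Real.exp 1 := by
        rw [← Real.exp_nat_mul]
        norm_num
      have := Real.exp_one_lt_d9
      nlinarith [Real.exp_pos (1 / 2)]
    have h8 : t ^ 4 = (v⁻¹) ^ 2 := by rw [← ht2]; ring
    rw [h8, inv_pow, inv_mul_le_iff₀ (by positivity)] at h5
    nlinarith [pow_pos h 2]

end Gaussian

/-! ### The Lindeberg condition -/

section Lindeberg

variable {ι : Type*} {μ ν : Measure (ι → ℝ)} [IsProbabilityMeasure μ] [IsProbabilityMeasure ν]
  {a : ι} {s δ : ℝ}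

theorem sq_le_indicator_add (T y : ℝ) :
    y ^ 2 ≤ T ^ 2 + {y : ℝ | T < |y|}.indicator (fun y => y ^ 2) y := by
  by_cases h : T < |y|
  · rw [Set.indicator_of_mem (by exact h)]
    nlinarith
  · rw [Set.indicator_of_notMem (by exact h), add_zero, ← sq_abs y]
    exact pow_le_pow_left₀ (abs_nonneg y) (not_lt.1 h) 2

theorem lindebergWeight_le_indicator (hs : 0 < s) (hδ : 0 ≤ δ) (y : ℝ) :
    lindebergWeight s y ≤ δ * y ^ 2 + {y : ℝ | δ * s < |y|}.indicator (fun y => y ^ 2) y := by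
  by_cases h : δ * s < |y|
  · rw [Set.indicator_of_mem (by exact h)]
    have := lindebergWeight_le_sq s y
    nlinarith [sq_nonneg y]
  · rw [Set.indicator_of_notMem (by exact h), add_zero, lindebergWeight, mul_comm]
    exact mul_le_mul_of_nonneg_right ((min_le_right _ _).trans ((div_le_iff₀ hs).2 (not_lt.1 h)))
      (sq_nonneg y)

/-- With u = |y|/s this is u ≤ δ + u²/δ times y². It serves the Gaussian field, for which fourth
moments are controlled by the variance. -/
theorem lindebergWeight_le_pow_four (hs : 0 < s) (hδ : 0 < δ) (y : ℝ) :
    lindebergWeight s y ≤ δ * y ^ 2 + y ^ 4 / (δ * s ^ 2) := by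
  have h1 : |y| / s ≤ δ + y ^ 2 / (δ * s ^ 2) := by
    rw [← sq_abs y]
    have e : δ + |y| ^ 2 / (δ * s ^ 2) - |y| / s
        = ((δ - |y| / s) ^ 2 + δ * (|y| / s)) / δ := by
      field_simp
      ring
    have : 0 ≤ ((δ - |y| / s) ^ 2 + δ * (|y| / s)) / δ := by positivity
    linarith
  calc lindebergWeight s y ≤ y ^ 2 * (δ + y ^ 2 / (δ * s ^ 2)) :=
        mul_le_mul_of_nonneg_left ((min_le_right _ _).trans h1) (sq_nonneg y)
    _ = _ := by ring

theorem measurableSet_lt_abs (T : ℝ) : MeasurableSet {y : ℝ | T < |y|} :=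
  measurableSet_lt measurable_const measurable_abs

omit [IsProbabilityMeasure μ] in
theorem integrable_indicator_sq (hμ : MemLp (fun x : ι → ℝ => x a) 2 μ) (T : ℝ) :
    Integrable (fun x => {y : ℝ | T < |y|}.indicator (fun y => y ^ 2) (x a)) μ :=
  hμ.integrable_sq.indicator (s := (fun x : ι → ℝ => x a) ⁻¹' {y : ℝ | T < |y|})
    ((measurable_pi_apply a) (measurableSet_lt_abs T))

omit [IsProbabilityMeasure μ] in
theorem integral_lindebergWeight_le (hs : 0 < s) (hδ : 0 ≤ δ)
    (hμ : MemLp (fun x : ι → ℝ => x a) 2 μ) :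
    ∫ x, lindebergWeight s (x a) ∂μ ≤ δ * ∫ x, x a ^ 2 ∂μ +
      ∫ x, {y : ℝ | δ * s < |y|}.indicator (fun y => y ^ 2) (x a) ∂μ := by
  rw [← integral_const_mul, ← integral_add (hμ.integrable_sq.const_mul _)
    (integrable_indicator_sq hμ _)]
  exact integral_mono (integrable_lindebergWeight_eval hs.le hμ)
    ((hμ.integrable_sq.const_mul _).add (integrable_indicator_sq hμ _))
    fun x => lindebergWeight_le_indicator hs hδ _

/-- A Gaussian variable with the same variance inherits the Lindeberg bound. -/
theorem integral_lindebergWeight_gaussian_le (hs : 0 < s) (hδ : 0 < δ)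
    (hμ : MemLp (fun x : ι → ℝ => x a) 2 μ) (hν : HasGaussianLaw (fun x : ι → ℝ => x a) ν)
    (hmean : ∫ x, x a ∂ν = 0) (hvar : ∫ x, x a ^ 2 ∂μ = ∫ x, x a ^ 2 ∂ν) :
    ∫ x, lindebergWeight s (x a) ∂ν ≤ 97 * δ * ∫ x, x a ^ 2 ∂μ +
      2 * ∫ x, {y : ℝ | δ / 2 * s < |y|}.indicator (fun y => y ^ 2) (x a) ∂μ := by
  set v := ∫ x, x a ^ 2 ∂μ with hv
  set L := ∫ x, {y : ℝ | δ / 2 * s < |y|}.indicator (fun y => y ^ 2) (x a) ∂μ with hL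
  have hv0 : 0 ≤ v := integral_nonneg fun x => sq_nonneg _
  have hL0 : 0 ≤ L := integral_nonneg fun x => Set.indicator_nonneg (fun y _ => sq_nonneg _) _
  -- Small variance: the fourth moment gives 96 v²/(δ s²) ≤ 96 δ v, whence 97. Large variance: v ≤
  -- δ²s²/4 + L < v/4 + L, so v ≤ 2L, and the weight is at most the square.
  rcases le_or_gt v (δ ^ 2 * s ^ 2) with h | h
  · obtain ⟨hi4, h4⟩ := integral_pow_four_le_of_gaussian hν hmean
    rw [← hvar] at h4
    have h1 : ∫ x, lindebergWeight s (x a) ∂ν ≤ δ * v + (∫ x, x a ^ 4 ∂ν) / (δ * s ^ 2) := by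
      rw [hvar, ← integral_const_mul, ← integral_div, ← integral_add
        (hν.memLp_two.integrable_sq.const_mul _) (hi4.div_const _)]
      exact integral_mono (integrable_lindebergWeight_eval hs.le hν.memLp_two)
        ((hν.memLp_two.integrable_sq.const_mul _).add (hi4.div_const _))
        fun x => lindebergWeight_le_pow_four hs hδ _
    have h2 : (∫ x, x a ^ 4 ∂ν) / (δ * s ^ 2) ≤ 96 * δ * v := by
      rw [div_le_iff₀ (by positivity)]
      have : v * v ≤ (δ ^ 2 * s ^ 2) * v := mul_le_mul_of_nonneg_right h hv0
      nlinarith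
    linarith
  · have h1 : ∫ x, lindebergWeight s (x a) ∂ν ≤ v := by
      rw [hvar]
      exact integral_mono (integrable_lindebergWeight_eval hs.le hν.memLp_two)
        hν.memLp_two.integrable_sq fun x => lindebergWeight_le_sq s _
    have h2 : v ≤ (δ / 2 * s) ^ 2 + L := by
      have := integral_mono hμ.integrable_sq
        ((integrable_const ((δ / 2 * s) ^ 2)).add (integrable_indicator_sq hμ (δ / 2 * s)))
        fun x => sq_le_indicator_add (δ / 2 * s) (x a)
      rwa [integral_add' (integrable_const _) (integrable_indicator_sq hμ _), integral_const,
        probReal_univ, one_smul] at this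
    have h3 : 0 ≤ 97 * δ * v := by positivity
    nlinarith

end Lindeberg

/-! ### Convergence of the Stieltjes transforms -/

section Convergence

variable {Ω : Type*} [MeasurableSpace Ω] {P : Measure Ω} [IsProbabilityMeasure P]
  {X : (n : ℕ) → Ω → Matrix (Fin n) (Fin n) ℝ}

/-- The law of the entries on and below the diagonal. -/
noncomputable def entriesLaw {Ω : Type*} [MeasurableSpace Ω] (P : Measure Ω) {n : ℕ}
    (M : Ω → Matrix (Fin n) (Fin n) ℝ) : Measure (LowerIdx n → ℝ) :=
  P.map fun ω (p : LowerIdx n) => M ω p.1.1 p.1.2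

theorem integral_entriesLaw {Ω : Type*} [MeasurableSpace Ω] {P : Measure Ω} {n : ℕ}
    {M : Ω → Matrix (Fin n) (Fin n) ℝ} {E : Type*} [NormedAddCommGroup E] [NormedSpace ℝ E]
    (hM : AEMeasurable (fun ω (p : LowerIdx n) => M ω p.1.1 p.1.2) P)
    {g : (LowerIdx n → ℝ) → E} (hg : AEStronglyMeasurable g (entriesLaw P M)) :
    ∫ x, g x ∂(entriesLaw P M) = ∫ ω, g (fun p => M ω p.1.1 p.1.2) ∂P :=
  integral_map hM hg

theorem measurable_entries (hXmeas : ∀ (n : ℕ) (k l : Fin n), Measurable (fun ω => X n ω k l))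
    (n : ℕ) : Measurable fun ω (p : LowerIdx n) => X n ω p.1.1 p.1.2 :=
  measurable_pi_iff.2 fun _ => hXmeas n _ _

theorem centeredField_entriesLaw {n K : ℕ} {M : Ω → Matrix (Fin n) (Fin n) ℝ}
    (hM : ∀ k l, Measurable fun ω => M ω k l)
    (h1 : ∀ p : LowerIdx n, MemLp (fun ω => M ω p.1.1 p.1.2) 2 P ∧ ∫ ω, M ω p.1.1 p.1.2 ∂P = 0)
    (h3 : ∀ A B : Set (LowerIdx n), A.Nonempty → B.Nonempty →
      (∀ p ∈ A, ∀ q ∈ B, (K : ℤ) < gridDist p q) →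
      Indep (entriesSigma M A) (entriesSigma M B) P) :
    CenteredField (gridNbhd K) (entriesLaw P M) := by
  have hY : Measurable fun ω (p : LowerIdx n) => M ω p.1.1 p.1.2 :=
    measurable_pi_iff.2 fun p => hM _ _
  refine ⟨fun a => ?_, fun a => ?_, locallyDependent_map hM h3⟩
  · exact (memLp_map_measure_iff (measurable_pi_apply a).aestronglyMeasurable
      hY.aemeasurable).2 (h1 a).1
  · rw [integral_entriesLaw hY.aemeasurable (measurable_pi_apply a).aestronglyMeasurable]
    exact (h1 a).2

/-- Borel-Cantelli for each threshold 1/(k+1); countably many thresholds suffice for almost sure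
convergence. -/
theorem tendsto_lowerStieltjes_sub_integral
    (hXmeas : ∀ (n : ℕ) (k l : Fin n), Measurable (fun ω => X n ω k l))
    {K : ℕ} (hdep : ∀ n, 0 < n → LocallyDependent (gridNbhd K) (entriesLaw P (X n)))
    {z : ℂ} (hz : 0 < z.im) :
    ∀ᵐ ω ∂P, Tendsto (fun n : ℕ => lowerStieltjes z (fun p : LowerIdx n => X n ω p.1.1 p.1.2) -
      ∫ x, lowerStieltjes z x ∂(entriesLaw P (X n))) atTop (𝓝 0) := by
  set D : ℕ → Ω → ℂ := fun n ω => lowerStieltjes z (fun p : LowerIdx n => X n ω p.1.1 p.1.2) -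
      ∫ x, lowerStieltjes z x ∂(entriesLaw P (X n)) with hD
  have hev : ∀ k : ℕ, ∀ᵐ ω ∂P, ∀ᶠ n in atTop, ‖D n ω‖ < 1 / ((k : ℝ) + 1) := by
    intro k
    set ε : ℝ := 1 / ((k : ℝ) + 1) with hε
    have hε0 : 0 < ε := by positivity
    set r : ℝ := (ε / 2) ^ 2 * z.im ^ 2 / (128 * (K + 1) ^ 2) with hr
    have hr0 : 0 < r := by positivity
    have hb : ∀ n, P {ω | ε ≤ ‖D n ω‖} ≤ ENNReal.ofReal (4 * Real.exp (-r * n)) := by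
      intro n
      rw [← ofReal_measureReal (μ := P)]
      refine ENNReal.ofReal_le_ofReal ?_
      rcases Nat.eq_zero_or_pos n with rfl | hn
      -- At n = 0 the claimed bound is 4, so a probability satisfies it trivially.
      · refine measureReal_le_one.trans ?_
        simp
      · have hY := measurable_entries hXmeas n
        have : IsProbabilityMeasure (entriesLaw P (X n)) :=
          Measure.isProbabilityMeasure_map hY.aemeasurable
        obtain ⟨B, hB⟩ := lower_taylorData hn hz
        have hconc := measure_lowerStieltjes_ge_le hz hn (hdep n hn) hε0.le
        have hset : MeasurableSet {x : LowerIdx n → ℝ | ε ≤ ‖lowerStieltjes z x -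
            ∫ x, lowerStieltjes z x ∂(entriesLaw P (X n))‖} :=
          measurableSet_le measurable_const (hB.continuous.measurable.sub_const _).norm
        have hmap : (entriesLaw P (X n)).real {x : LowerIdx n → ℝ | ε ≤ ‖lowerStieltjes z x -
            ∫ x, lowerStieltjes z x ∂(entriesLaw P (X n))‖} = P.real {ω | ε ≤ ‖D n ω‖} :=
          map_measureReal_apply hY hset
        rwa [hmap] at hconc
    have hsum : ∑' n, P {ω | ε ≤ ‖D n ω‖} ≠ ⊤ := by
      refine ne_top_of_le_ne_top ?_ (ENNReal.tsum_le_tsum hb)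
      refine Summable.tsum_ofReal_ne_top (Summable.mul_left 4 ?_)
      simpa [mul_comm] using (Real.summable_exp_nat_mul_iff (a := -r)).2 (neg_lt_zero.2 hr0)
    filter_upwards [ae_eventually_notMem hsum] with ω hω
    exact hω.mono fun n hn => not_le.1 hn
  filter_upwards [ae_all_iff.2 hev] with ω hω
  rw [tendsto_zero_iff_norm_tendsto_zero, Metric.tendsto_atTop']
  intro ε hε
  obtain ⟨k, hk⟩ := exists_nat_one_div_lt hε
  obtain ⟨n₀, hn₀⟩ := eventually_atTop.1 (hω k)
  refine ⟨n₀, fun n hn => ?_⟩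
  rw [dist_zero_right, norm_norm]
  exact (hn₀ n hn.le).trans hk

theorem norm_integral_entriesLaw_sub_le {K n : ℕ} (hn : 0 < n) {z : ℂ} (hz : 0 < z.im)
    {μ ν : Measure (LowerIdx n → ℝ)} [IsProbabilityMeasure μ] [IsProbabilityMeasure ν]
    (hμ : CenteredField (gridNbhd K) μ) (hν : HasGaussianLaw (id : (LowerIdx n → ℝ) → _) ν)
    (hmean : ∀ a, ∫ x, x a ∂ν = 0) (hcov : ∀ a b, ∫ x, x a * x b ∂μ = ∫ x, x a * x b ∂ν)
    {δ : ℝ} (hδ : 0 < δ) :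
    ‖∫ x, lowerStieltjes z x ∂μ - ∫ x, lowerStieltjes z x ∂ν‖ ≤
      (16 * z.im⁻¹ ^ 3 + 48 * z.im⁻¹ ^ 4) * (36 * ((2 * K + 1) ^ 2) ^ 2) *
        (98 * δ * ((1 / (n : ℝ) ^ 2) * ∑ a, ∫ x, x a ^ 2 ∂μ) +
          3 * ((1 / (n : ℝ) ^ 2) * ∑ a, ∫ x,
            {y : ℝ | δ / 2 * √(n : ℝ) < |y|}.indicator (fun y => y ^ 2) (x a) ∂μ)) := by
  obtain ⟨B, hB⟩ := lower_taylorData hn hz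
  have hne : Nonempty (LowerIdx n) := ⟨⟨(⟨0, hn⟩, ⟨0, hn⟩), le_rfl⟩⟩
  have hs : 0 < √(n : ℝ) := Real.sqrt_pos.2 (Nat.cast_pos.2 hn)
  have hνc := centeredField_of_gaussian hμ hν hmean hcov
  have hmain := norm_integral_sub_integral_le hs.le (gridNbhd_symm K) (card_gridNbhd_le K)
    hμ hνc hcov hB
  have hterm : ∀ a, ∫ x, lindebergWeight √(n : ℝ) (x a) ∂μ + ∫ x, lindebergWeight √(n : ℝ) (x a) ∂ν
      ≤ 98 * δ * ∫ x, x a ^ 2 ∂μ + 3 * ∫ x,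
        {y : ℝ | δ / 2 * √(n : ℝ) < |y|}.indicator (fun y => y ^ 2) (x a) ∂μ := by
    intro a
    -- Taking δ/2 here makes the truncation level agree with that of the Gaussian bound; the
    -- coefficients 1/2 + 97 are rounded up to 98.
    have h1 := integral_lindebergWeight_le hs (half_pos hδ).le (hμ.memLp a)
    have h2 := integral_lindebergWeight_gaussian_le hs hδ (hμ.memLp a)
      (hν.map (ContinuousLinearMap.proj (R := ℝ) (φ := fun _ : LowerIdx n => ℝ) a))
      (hmean a) (by simpa [sq] using hcov a a)
    have h3 : 0 ≤ δ * ∫ x, x a ^ 2 ∂μ :=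
      mul_nonneg hδ.le (integral_nonneg fun x => sq_nonneg _)
    linarith
  refine hmain.trans ?_
  have hsum := (Finset.sum_le_sum fun a (_ : a ∈ Finset.univ) => hterm a).trans_eq
    (Finset.sum_add_distrib)
  rw [← Finset.mul_sum, ← Finset.mul_sum] at hsum
  have hc := hB.coeff_nonneg
  refine (mul_le_mul_of_nonneg_left (mul_le_mul_of_nonneg_left hsum (by positivity)) hc).trans
    (le_of_eq ?_)
  push_cast
  ring

theorem tendsto_integral_entriesLaw_sub
    (hXmeas : ∀ (n : ℕ) (k l : Fin n), Measurable (fun ω => X n ω k l))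
    (hA1 : AssumptionA1 P X) (hA2 : AssumptionA2 P X) {K : ℕ}
    (hX : ∀ n, 0 < n → CenteredField (gridNbhd K) (entriesLaw P (X n)))
    {ν : (n : ℕ) → Measure (LowerIdx n → ℝ)} (hνp : ∀ n, IsProbabilityMeasure (ν n))
    (hν : ∀ n, 0 < n → HasGaussianLaw (id : (LowerIdx n → ℝ) → _) (ν n))
    (hmean : ∀ n, 0 < n → ∀ a, ∫ x, x a ∂(ν n) = 0)
    (hcov : ∀ n, 0 < n → ∀ a b,
      ∫ x, x a * x b ∂(entriesLaw P (X n)) = ∫ x, x a * x b ∂(ν n))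
    {z : ℂ} (hz : 0 < z.im) :
    Tendsto (fun n => ∫ x, lowerStieltjes z x ∂(entriesLaw P (X n)) -
      ∫ x, lowerStieltjes z x ∂(ν n)) atTop (𝓝 0) := by
  obtain ⟨C, hC⟩ := hA1.2
  set A : ℝ := (16 * z.im⁻¹ ^ 3 + 48 * z.im⁻¹ ^ 4) * (36 * ((2 * K + 1) ^ 2) ^ 2) with hA
  have hA0 : 0 < A := by
    have := inv_pos.2 hz
    positivity
  rw [tendsto_zero_iff_norm_tendsto_zero, Metric.tendsto_atTop']
  intro ε hε
  -- Makes the variance term at most ε/2. The threshold for the Lindeberg tail is then chosen,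
  -- depending on this δ, so that the tail term is below ε/2.
  set δ : ℝ := ε / (2 * (A * 98 * (|C| + 1))) with hδ
  have hδ0 : 0 < δ := by positivity
  obtain ⟨n₀, hn₀⟩ := eventually_atTop.1 ((hA2 (δ / 2) (half_pos hδ0)).eventually
    (gt_mem_nhds (show 0 < ε / (2 * (A * 3)) by positivity)))
  refine ⟨n₀, fun n hn => ?_⟩
  -- The neighbourhood of infinity is given by the strict inequality n > n₀, which excludes n = 0.
  have hn0 : 0 < n := by omega
  have hY := measurable_entries hXmeas n
  have : IsProbabilityMeasure (entriesLaw P (X n)) :=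
    Measure.isProbabilityMeasure_map hY.aemeasurable
  have := hνp n
  have hb := norm_integral_entriesLaw_sub_le hn0 hz (hX n hn0) (hν n hn0) (hmean n hn0)
    (hcov n hn0) hδ0
  have e1 : ∀ a, ∫ x, x a ^ 2 ∂(entriesLaw P (X n)) = ∫ ω, |X n ω a.1.1 a.1.2| ^ 2 ∂P := fun a => by
    simp only [sq_abs]
    exact integral_entriesLaw hY.aemeasurable
      ((measurable_pi_apply a).pow_const 2).aestronglyMeasurable
  have e2 : ∀ a, ∫ x, {y : ℝ | δ / 2 * √(n : ℝ) < |y|}.indicator (fun y => y ^ 2) (x a)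
      ∂(entriesLaw P (X n)) = ∫ ω in {ω | δ / 2 * √(n : ℝ) < |X n ω a.1.1 a.1.2|},
        |X n ω a.1.1 a.1.2| ^ 2 ∂P := fun a => by
    rw [integral_entriesLaw hY.aemeasurable
      (integrable_indicator_sq ((hX n hn0).memLp a) _).aestronglyMeasurable,
      ← integral_indicator (measurableSet_lt measurable_const (hXmeas n _ _).abs)]
    simp only [sq_abs]
    rfl
  simp only [e1, e2] at hb
  have h1 := hC n hn0
  have h2 := hn₀ n hn.le
  rw [dist_zero_right, norm_norm]
  refine hb.trans_lt ?_
  have h3 : A * (98 * δ * ((1 / (n : ℝ) ^ 2) * ∑ a : LowerIdx n,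
      ∫ ω, |X n ω a.1.1 a.1.2| ^ 2 ∂P)) ≤ ε / 2 := by
    calc _ ≤ A * (98 * δ * (|C| + 1)) := by
          gcongr
          exact h1.trans ((le_abs_self C).trans (by linarith))
      _ = ε / 2 := by
          rw [hδ]
          field_simp
  have h4 := mul_lt_mul_of_pos_left h2 (show 0 < A * 3 by positivity)
  have h5 : A * 3 * (ε / (2 * (A * 3))) = ε / 2 := by field_simp
  rw [mul_add]
  linarith

end Convergence

end Universality

/-! ### Conclusion: concentration combined with comparison of the means -/

theorem mainTheorem2 {Ω : Type*} [MeasurableSpace Ω] (P : Measure Ω) [IsProbabilityMeasure P]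
    (X : (n : ℕ) → Ω → Matrix (Fin n) (Fin n) ℝ)
    (hXsymm : ∀ n ω, (X n ω).IsSymm)
    (hXmeas : ∀ (n : ℕ) (k l : Fin n), Measurable (fun ω => X n ω k l))
    (hA1 : AssumptionA1 P X) (hA2 : AssumptionA2 P X) (hA3 : AssumptionA3 P X)
    {Ω' : ℕ → Type*} [∀ n, MeasurableSpace (Ω' n)]
    (Q : (n : ℕ) → Measure (Ω' n)) [∀ n, IsProbabilityMeasure (Q n)]
    (G : (n : ℕ) → Ω' n → Matrix (Fin n) (Fin n) ℝ)
    (hGsymm : ∀ n ω, (G n ω).IsSymm)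
    (hGgauss : ∀ n : ℕ, 0 < n →
      HasGaussianLaw (fun ω (p : LowerIdx n) => G n ω p.1.1 p.1.2) (Q n))
    (hGmean : ∀ n : ℕ, 0 < n → ∀ p : LowerIdx n, ∫ ω, G n ω p.1.1 p.1.2 ∂(Q n) = 0)
    (hGcov : ∀ n : ℕ, 0 < n → ∀ p q : LowerIdx n,
      ∫ ω, G n ω p.1.1 p.1.2 * G n ω q.1.1 q.1.2 ∂(Q n) =
        ∫ ω, X n ω p.1.1 p.1.2 * X n ω q.1.1 q.1.2 ∂P)
    (z : ℂ) (hz : 0 < z.im) :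
    (∀ n : ℕ, 0 < n → Integrable (fun ω => stieltjes ((√(n : ℝ))⁻¹ • G n ω) z) (Q n)) ∧
    ∀ᵐ ω ∂P, Tendsto (fun n : ℕ =>
        ‖stieltjes ((√(n : ℝ))⁻¹ • X n ω) z -
          ∫ ω', stieltjes ((√(n : ℝ))⁻¹ • G n ω') z ∂(Q n)‖)
      atTop (𝓝 0) := by
  have hGlaw : ∀ n, 0 < n → AEMeasurable (fun ω (p : LowerIdx n) => G n ω p.1.1 p.1.2) (Q n) :=
    fun n hn => (hGgauss n hn).aemeasurable
  have hcont : ∀ n, 0 < n → Continuous (lowerStieltjes (n := n) z) := fun n hn => by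
    obtain ⟨B, hB⟩ := lower_taylorData hn hz
    exact hB.continuous
  have hGst : ∀ (n : ℕ) ω, stieltjes ((√(n : ℝ))⁻¹ • G n ω) z
      = lowerStieltjes z (fun p : LowerIdx n => G n ω p.1.1 p.1.2) :=
    fun n ω => stieltjes_eq_lowerStieltjes _ (hGsymm n ω) hz
  have hXst : ∀ (n : ℕ) ω, stieltjes ((√(n : ℝ))⁻¹ • X n ω) z
      = lowerStieltjes z (fun p : LowerIdx n => X n ω p.1.1 p.1.2) :=
    fun n ω => stieltjes_eq_lowerStieltjes _ (hXsymm n ω) hz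
  simp only [hGst, hXst]
  refine ⟨fun n hn => Integrable.of_bound (C := z.im⁻¹)
    ((hcont n hn).measurable.comp_aemeasurable (hGlaw n hn)).aestronglyMeasurable
    (Eventually.of_forall fun ω => norm_lowerStieltjes_le hn hz _), ?_⟩
  obtain ⟨K, hK, h3⟩ := hA3
  have hX : ∀ n, 0 < n → CenteredField (gridNbhd K) (entriesLaw P (X n)) := fun n hn =>
    centeredField_entriesLaw (hXmeas n) (hA1.1 n hn) (h3 n hn)
  obtain ⟨ν, hν, hνp⟩ : ∃ ν : (n : ℕ) → Measure (LowerIdx n → ℝ),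
      (∀ n, 0 < n → ν n = entriesLaw (Q n) (G n)) ∧ ∀ n, IsProbabilityMeasure (ν n) := by
    -- Nothing is assumed on `G` at n = 0, not even measurability; a Dirac mass fills this index so
    -- that every `ν n` is a probability measure.
    refine ⟨fun n => if 0 < n then entriesLaw (Q n) (G n) else Measure.dirac 0,
      fun n hn => if_pos hn, fun n => ?_⟩
    by_cases hn : 0 < n
    · simp only [if_pos hn]
      exact Measure.isProbabilityMeasure_map (hGlaw n hn)
    · simp only [if_neg hn]
      infer_instance
  have hcomp := tendsto_integral_entriesLaw_sub hXmeas hA1 hA2 hX hνp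
    (fun n hn => by
      rw [hν n hn]
      have : IsGaussian (entriesLaw (Q n) (G n)) := (hGgauss n hn).isGaussian_map
      exact IsGaussian.hasGaussianLaw_id (μ := entriesLaw (Q n) (G n)))
    (fun n hn a => by
      rw [hν n hn, integral_entriesLaw (hGlaw n hn) (measurable_pi_apply a).aestronglyMeasurable]
      exact hGmean n hn a)
    (fun n hn a b => by
      have hm : Measurable fun x : LowerIdx n → ℝ => x a * x b :=
        (measurable_pi_apply a).mul (measurable_pi_apply b)
      rw [hν n hn, integral_entriesLaw (hGlaw n hn) hm.aestronglyMeasurable,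
        integral_entriesLaw (measurable_entries hXmeas n).aemeasurable hm.aestronglyMeasurable]
      exact (hGcov n hn a b).symm) hz
  filter_upwards [tendsto_lowerStieltjes_sub_integral hXmeas (fun n hn => (hX n hn).dep) hz]
    with ω hω
  rw [← tendsto_zero_iff_norm_tendsto_zero]
  have hsum := hω.add hcomp
  rw [add_zero] at hsum
  refine hsum.congr' ?_
  filter_upwards [eventually_gt_atTop 0] with n hn
  rw [sub_add_sub_cancel, hν n hn,
    integral_entriesLaw (hGlaw n hn) (hcont n hn).measurable.aestronglyMeasurable]
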